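/- **Notation.** Let $n\ge 1$. Suprema over $B$ run over all balls of $\mathbb{R}^n$, $|B|$ is the Lebesgue measure of $B$, and $f_B=\frac1{|B|}\int_B f$. A locally integrable function $f:\mathbb{R}^n\to\mathbb{C}$ belongs to $\mathrm{BMO}(\mathbb{R}^n)$ if $\|f\|_{\mathrm{BMO}}:=\sup_B\frac1{|B|}\int_B|f(x)-f_B|\,dx<\infty$. A locally integrable function $g$, real-valued (possibly after modification on a null set), belongs to $\mathrm{BLO}(\mathbb{R}^n)$ if $\|g\|_{\mathrm{BLO}}:=\sup_B\frac1{|B|}\int_B\bigl[g(x)-\operatorname*{ess\,inf}_{y\in B}g(y)\bigr]dx<\infty$. For a real-valued Schwartz function $\phi$ on $\mathbb{R}^n$ and $t>0$ put $\phi_t(x)=t^{-n}\phi(x/t)$ and $\Phi_tf=\phi_t*f$. For a sequence $\boldsymbol a=\{a_i\}_{i\in\mathbb{Z}}$ of positive numbers and a bounded sequence $\boldsymbol v=\{v_i\}_{i\in\mathbb{Z}}$ of complex numbers, the maximal differential transform is the $[0,\infty]$-valued function $$\mathcal{S}_{\boldsymbol a,\boldsymbol v;*}(\{\Phi_t\}_{t>0},f)(x):=\sup_{N_1,N_2\in\mathbb{Z},\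 N_1<N_2}\Bigl|\sum_{i=N_1}^{N_2}v_i\bigl(\Phi_{a_{i+1}}f(x)-\Phi_{a_i}f(x)\bigr)\Bigr|.$$ **Theorem.** Let $\phi$ be a real-valued Schwartz function on $\mathbb{R}^n$ with $\int_{\mathbb{R}^n}\phi(x)\,dx=1$, let $\delta>1$, let $\boldsymbol a=\{a_i\}_{i\in\mathbb{Z}}$ be a sequence of positive numbers with $\delta\le a_{i+1}/a_i\le\delta^2$ for all $i\in\mathbb{Z}$, and let $\boldsymbol v=\{v_i\}_{i\in\mathbb{Z}}$ be a bounded sequence of complex numbers. Then for every $f\in\mathrm{BMO}(\mathbb{R}^n)$ the function $\mathcal{S}_{\boldsymbol a,\boldsymbol v;*}(\{\Phi_t\}_{t>0},f)$ is either infinite everywhere or finite almost everywhere. In the latter case it belongs to $\mathrm{BLO}(\mathbb{R}^n)$ and $$\|\mathcal{S}_{\boldsymbol a,\boldsymbol v;*}(\{\Phi_t\}_{t>0},f)\|_{\mathrm{BLO}}\le C\,\|f\|_{\mathrm{BMO}},$$ where the constant $C>0$ depends only on $n$, $\|\boldsymbol v\|_{\ell^\infty(\mathbb{Z})}$, $\delta$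 and $\phi$ (and not otherwise on $\boldsymbol a$, $\boldsymbol v$ or on $f$). -/

import Mathlib

open MeasureTheory Metric
open scoped SchwartzMap ENNReal

/-- The `BMO` seminorm: the supremum over all balls `B` of `|B|⁻¹ ∫_B |f - f_B|`. -/
noncomputable def bmoNorm {n : ℕ} (f : EuclideanSpace ℝ (Fin n) → ℂ) : ℝ≥0∞ :=
  ⨆ (c : EuclideanSpace ℝ (Fin n)) (r : ℝ) (_ : 0 < r),
    (volume (ball c r))⁻¹ * ∫⁻ x in ball c r, ‖f x - ⨍ y in ball c r, f y‖ₑ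

/-- `f` is a locally integrable function of bounded mean oscillation. -/
def MemBMO {n : ℕ} (f : EuclideanSpace ℝ (Fin n) → ℂ) : Prop :=
  LocallyIntegrable f ∧ bmoNorm f < ∞

/-- The `BLO` "norm": the supremum over all balls `B` of `|B|⁻¹ ∫_B (g - ess inf_B g)`.
The essential infimum is taken in the extended reals, so it is `-∞` (and the integral is
infinite) when `g` is not essentially bounded below on `B`; the integrand is nonnegative
almost everywhere on `B`, so that `EReal.toENNReal` loses nothing. -/
noncomputable def bloNorm {n : ℕ} (g : EuclideanSpace ℝ (Fin n) → ℝ) : ℝ≥0∞ :=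
  ⨆ (c : EuclideanSpace ℝ (Fin n)) (r : ℝ) (_ : 0 < r),
    (volume (ball c r))⁻¹ * ∫⁻ x in ball c r,
      ((g x : EReal) - essInf (fun y => (g y : EReal)) (volume.restrict (ball c r))).toENNReal

/-- `g` is a locally integrable function of bounded lower oscillation. -/
def MemBLO {n : ℕ} (g : EuclideanSpace ℝ (Fin n) → ℝ) : Prop :=
  LocallyIntegrable g ∧ bloNorm g < ∞

/-- The dilation `φ_t(x) = t⁻ⁿ φ(x / t)`. -/
noncomputable def dilation {n : ℕ} (φ : EuclideanSpace ℝ (Fin n) → ℝ) (t : ℝ)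
    (x : EuclideanSpace ℝ (Fin n)) : ℝ :=
  (t ^ n)⁻¹ * φ (t⁻¹ • x)

/-- The convolution operator `Φ_t f = φ_t * f`. -/
noncomputable def convOp {n : ℕ} (φ : EuclideanSpace ℝ (Fin n) → ℝ) (t : ℝ)
    (f : EuclideanSpace ℝ (Fin n) → ℂ) : EuclideanSpace ℝ (Fin n) → ℂ :=
  convolution (dilation φ t) f (ContinuousLinearMap.lsmul ℝ ℝ) volume

/-- The partial sum `∑_{i = N₁}^{N₂} v_i (Φ_{a_{i+1}} f(x) - Φ_{a_i} f(x))`. -/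
noncomputable def diffTransform {n : ℕ} (φ : EuclideanSpace ℝ (Fin n) → ℝ) (a : ℤ → ℝ)
    (v : ℤ → ℂ) (N₁ N₂ : ℤ) (f : EuclideanSpace ℝ (Fin n) → ℂ)
    (x : EuclideanSpace ℝ (Fin n)) : ℂ :=
  ∑ i ∈ Finset.Icc N₁ N₂, v i * (convOp φ (a (i + 1)) f x - convOp φ (a i) f x)

/-- The maximal differential transform, with values in `[0, ∞]`. -/
noncomputable def maxDiffTransform {n : ℕ} (φ : EuclideanSpace ℝ (Fin n) → ℝ) (a : ℤ → ℝ)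
    (v : ℤ → ℂ) (f : EuclideanSpace ℝ (Fin n) → ℂ) (x : EuclideanSpace ℝ (Fin n)) : ℝ≥0∞ :=
  ⨆ (N₁ : ℤ) (N₂ : ℤ) (_ : N₁ < N₂), ‖diffTransform φ a v N₁ N₂ f x‖ₑ

/-- `a` is a `δ`-lacunary sequence of positive numbers. -/
def IsLacunary (δ : ℝ) (a : ℤ → ℝ) : Prop :=
  1 < δ ∧ (∀ i, 0 < a i) ∧ ∀ i, δ ≤ a (i + 1) / a i

/-!
The maximal differential transform `S` is compared at two points `x`, `y` of a ball `B` of radius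
`r`. The scales `a_i ≥ r` contribute almost the same at `x` and at `y`: since `∫ φ = 1`, constants
do not matter, and the decay of `φ` gives `|Φ_t f(x) - Φ_t f(y)| ≲ (r / t) ‖f‖_BMO` for `t ≥ r`,
which sums over a lacunary sequence to a multiple of `‖f‖_BMO`. At the scales `a_i < r` only the
local part `f₁ = (f - f_B) 1_{2B}` matters: the remaining part of `f` contributes
`≲ (a_i / r) ‖f‖_BMO`, which again is summable. Hence, for all `x, y ∈ B`,
`S(x) ≤ U(x) + S(y) + C ‖f‖_BMO`, where `U` is the maximal transform of `f₁`
(`maxDiffTransform_le`; there `U` is replaced by `s⁻¹ U² + s` with a free level `s`, which takes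
the place of the Cauchy–Schwarz inequality). Finiteness of `S` at a single point therefore makes `S`
finite almost everywhere on every ball, and taking the essential infimum over `y` bounds the lower
oscillation on `B` by the mean of `U` plus `C ‖f‖_BMO`.

The mean of `U` is estimated in `L²`, which takes two ingredients.

* The John–Nirenberg inequality in mean square (`ballAvg_sq_le`). For bounded `f` the best constant
  `A` in the mean square oscillation is finite, and stopping balls selected by the Vitali covering
  theorem (`exists_stopping_balls`) give `2 A ≤ 3 l² + A` with `l` a multiple of `‖f‖_BMO`; the
  general case follows by truncation.
* The `L²` boundedness of the maximal transform (`lintegral_iSup_diffTransform_le`). For a finite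
  window of scales with full sum `T` and tails `T_N`, the Fourier multiplier of `T_N - Φ_{a_N} T` is
  `O(min(a_N |ξ|, (a_N |ξ|)⁻¹))` (`MultBounded.norm_cotlarMult_le`), so that by Plancherel's theorem
  these differences are square summable in `N`, while `Φ_{a_N} T` is dominated by the
  Hardy–Littlewood maximal function of `T` (`lintegral_sq_le_of_le_hlMax`). This is carried out for
  Schwartz functions and extended to `L²` by Fatou's lemma.
-/

/-- The Euclidean space `ℝⁿ`. -/
abbrev Eucl (n : ℕ) := EuclideanSpace ℝ (Fin n)

/-! ### Averages over balls -/

/-- The average `|B|⁻¹ ∫_B h` of a nonnegative function over the ball `B = B(c, r)`. -/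
noncomputable def ballAvg {n : ℕ} (h : Eucl n → ℝ≥0∞) (c : Eucl n) (r : ℝ) : ℝ≥0∞ :=
  (volume (ball c r))⁻¹ * ∫⁻ x in ball c r, h x

theorem volume_ball_eq {n : ℕ} (c : Eucl n) {r : ℝ} (hr : 0 < r) :
    volume (ball c r) = ENNReal.ofReal (r ^ n) * volume (ball (0 : Eucl n) 1) := by
  simpa using Measure.addHaar_ball_of_pos (volume : Measure (Eucl n)) c hr

theorem volume_ball_mul {n : ℕ} (c c' : Eucl n) {κ r : ℝ} (hκ : 0 < κ) (hr : 0 < r) :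
    volume (ball c (κ * r)) = ENNReal.ofReal (κ ^ n) * volume (ball c' r) := by
  rw [volume_ball_eq c (mul_pos hκ hr), volume_ball_eq c' hr, mul_pow,
    ENNReal.ofReal_mul (by positivity), mul_assoc]

theorem volume_ball_ne_zero {n : ℕ} (c : Eucl n) {r : ℝ} (hr : 0 < r) :
    volume (ball c r) ≠ 0 := (measure_ball_pos _ c hr).ne'

theorem volume_ball_ne_top {n : ℕ} (c : Eucl n) (r : ℝ) :
    volume (ball c r) ≠ ∞ := measure_ball_lt_top.ne

theorem lintegral_ball_eq {n : ℕ} (h : Eucl n → ℝ≥0∞) (c : Eucl n) {r : ℝ} (hr : 0 < r) :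
    ∫⁻ x in ball c r, h x = volume (ball c r) * ballAvg h c r := by
  rw [ballAvg, ← mul_assoc, ENNReal.mul_inv_cancel (volume_ball_ne_zero c hr)
    (volume_ball_ne_top c r), one_mul]

theorem ballAvg_const {n : ℕ} (a : ℝ≥0∞) (c : Eucl n) {r : ℝ} (hr : 0 < r) :
    ballAvg (fun _ => a) c r = a := by
  rw [ballAvg, setLIntegral_const, mul_comm a, ← mul_assoc,
    ENNReal.inv_mul_cancel (volume_ball_ne_zero c hr) (volume_ball_ne_top c r), one_mul]

theorem ballAvg_add_const {n : ℕ} (h : Eucl n → ℝ≥0∞) (a : ℝ≥0∞) (c : Eucl n) {r : ℝ}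
    (hr : 0 < r) : ballAvg (fun x => h x + a) c r = ballAvg h c r + a := by
  rw [← ballAvg_const a c hr, ballAvg_const a c hr, ballAvg, lintegral_add_right _ measurable_const,
    mul_add, ← ballAvg, ← ballAvg, ballAvg_const a c hr]

theorem ballAvg_mono {n : ℕ} {h h' : Eucl n → ℝ≥0∞} (hh : ∀ x, h x ≤ h' x) (c : Eucl n) (r : ℝ) :
    ballAvg h c r ≤ ballAvg h' c r := by
  unfold ballAvg; gcongr; exact hh _

/-- An average over a ball is controlled by the average over any comparable larger ball. -/
theorem ballAvg_le_of_subset {n : ℕ} (h : Eucl n → ℝ≥0∞) {c c' : Eucl n} {r r' κ : ℝ}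
    (hr : 0 < r) (hr' : 0 < r') (hκ : 0 < κ) (hs : ball c r ⊆ ball c' r') (hrr : r' ≤ κ * r) :
    ballAvg h c r ≤ ENNReal.ofReal (κ ^ n) * ballAvg h c' r' := by
  have hv : volume (ball c' r') ≤ ENNReal.ofReal (κ ^ n) * volume (ball c r) := by
    rw [← volume_ball_mul c' c hκ hr]
    exact measure_mono (ball_subset_ball hrr)
  have h1 : (volume (ball c r))⁻¹ ≤ ENNReal.ofReal (κ ^ n) * (volume (ball c' r'))⁻¹ := by
    rw [← div_eq_mul_inv, ENNReal.le_div_iff_mul_le (Or.inl (volume_ball_ne_zero c' hr'))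
      (Or.inl (volume_ball_ne_top c' r')), mul_comm, ← div_eq_mul_inv]
    exact ENNReal.div_le_of_le_mul hv
  calc ballAvg h c r ≤ (ENNReal.ofReal (κ ^ n) * (volume (ball c' r'))⁻¹) *
        ∫⁻ x in ball c' r', h x := by
        unfold ballAvg; gcongr
    _ = _ := by rw [mul_assoc]; rfl

/-! ### Oscillations of a function of bounded mean oscillation -/

theorem ballAvg_le_bmoNorm {n : ℕ} (f : Eucl n → ℂ) (c : Eucl n) {r : ℝ} (hr : 0 < r) :
    ballAvg (fun x => ‖f x - ⨍ y in ball c r, f y‖ₑ) c r ≤ bmoNorm f :=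
  le_iSup_of_le c (le_iSup_of_le r (le_iSup_of_le hr le_rfl))

theorem integrableOn_ball {n : ℕ} {f : Eucl n → ℂ} (hf : LocallyIntegrable f) (c : Eucl n)
    (r : ℝ) : IntegrableOn f (ball c r) :=
  (hf.integrableOn_isCompact (isCompact_closedBall c r)).mono_set ball_subset_closedBall

theorem enorm_average_sub_le {n : ℕ} {f : Eucl n → ℂ} (hf : LocallyIntegrable f) (a : ℂ)
    (c : Eucl n) {r : ℝ} (hr : 0 < r) :
    ‖(⨍ y in ball c r, f y) - a‖ₑ ≤ ballAvg (fun x => ‖f x - a‖ₑ) c r := by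
  have hv : volume.real (ball c r) ≠ 0 :=
    (ENNReal.toReal_pos (volume_ball_ne_zero c hr) (volume_ball_ne_top c r)).ne'
  have h1 : (⨍ y in ball c r, f y) - a
      = (volume.real (ball c r))⁻¹ • ∫ y in ball c r, (f y - a) := by
    rw [setAverage_eq, integral_sub (integrableOn_ball hf c r)
      (integrableOn_const (volume_ball_ne_top c r)), setIntegral_const, smul_sub, smul_smul,
      inv_mul_cancel₀ hv, one_smul]
  rw [h1, enorm_smul, ballAvg]
  gcongr
  · rw [Measure.real, ← ENNReal.toReal_inv, ← ofReal_norm, Real.norm_of_nonneg (by positivity),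
      ENNReal.ofReal_toReal (ENNReal.inv_ne_top.2 (volume_ball_ne_zero c hr))]
  · exact enorm_integral_le_lintegral_enorm _

/-- The averages of a function over two nested comparable balls are close. -/
theorem enorm_average_sub_average_le {n : ℕ} {f : Eucl n → ℂ} (hf : LocallyIntegrable f)
    {c c' : Eucl n} {r r' κ : ℝ} (hr : 0 < r) (hr' : 0 < r') (hκ : 0 < κ)
    (hs : ball c r ⊆ ball c' r') (hrr : r' ≤ κ * r) :
    ‖(⨍ y in ball c r, f y) - ⨍ y in ball c' r', f y‖ₑ ≤ ENNReal.ofReal (κ ^ n) * bmoNorm f :=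
  (enorm_average_sub_le hf _ c hr).trans ((ballAvg_le_of_subset _ hr hr' hκ hs hrr).trans
    (by gcongr; exact ballAvg_le_bmoNorm f c' hr'))

theorem ballAvg_enorm_sub_le_add {n : ℕ} (f : Eucl n → ℂ) (a b : ℂ) (c : Eucl n) {r : ℝ}
    (hr : 0 < r) : ballAvg (fun x => ‖f x - a‖ₑ) c r
      ≤ ballAvg (fun x => ‖f x - b‖ₑ) c r + ‖b - a‖ₑ := by
  rw [← ballAvg_add_const _ _ _ hr]
  refine ballAvg_mono (fun x => ?_) c r
  calc ‖f x - a‖ₑ = ‖(f x - b) + (b - a)‖ₑ := by congr 1; ring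
    _ ≤ _ := enorm_add_le _ _

theorem enorm_average_sub_average_pow_le {n : ℕ} {f : Eucl n → ℂ} (hf : LocallyIntegrable f)
    (x : Eucl n) {t : ℝ} (ht : 0 < t) (k : ℕ) :
    ‖(⨍ y in ball x (2 ^ k * t), f y) - ⨍ y in ball x t, f y‖ₑ
      ≤ k * (ENNReal.ofReal (2 ^ n) * bmoNorm f) := by
  induction k with
  | zero => simp
  | succ k ih =>
    have h1 : ‖(⨍ y in ball x (2 ^ k * t), f y) - ⨍ y in ball x (2 ^ (k + 1) * t), f y‖ₑ
        ≤ ENNReal.ofReal (2 ^ n) * bmoNorm f :=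
      enorm_average_sub_average_le hf (by positivity) (by positivity) two_pos
        (ball_subset_ball (by gcongr <;> norm_num)) (by rw [pow_succ]; linarith)
    rw [← edist_eq_enorm_sub] at h1 ih ⊢
    calc _ ≤ _ := edist_triangle_left _ _ (⨍ y in ball x (2 ^ k * t), f y)
      _ ≤ ENNReal.ofReal (2 ^ n) * bmoNorm f + k * (ENNReal.ofReal (2 ^ n) * bmoNorm f) := by
        gcongr
      _ = _ := by push_cast; ring

/-- The mean oscillation over `B(x, 2ᵏ t)` around the average over `B(x, t)` grows at most
linearly in `k`. -/
theorem ballAvg_pow_le {n : ℕ} {f : Eucl n → ℂ} (hf : LocallyIntegrable f)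
    (x : Eucl n) {t : ℝ} (ht : 0 < t) (k : ℕ) :
    ballAvg (fun z => ‖f z - ⨍ y in ball x t, f y‖ₑ) x (2 ^ k * t)
      ≤ (k + 1) * (ENNReal.ofReal (2 ^ n) * bmoNorm f) := by
  have h2 : (1 : ℝ≥0∞) ≤ ENNReal.ofReal (2 ^ n) := by
    rw [ENNReal.one_le_ofReal]; exact one_le_pow₀ one_le_two
  calc _ ≤ bmoNorm f + k * (ENNReal.ofReal (2 ^ n) * bmoNorm f) :=
        (ballAvg_enorm_sub_le_add f _ _ x (by positivity)).trans
          (add_le_add (ballAvg_le_bmoNorm f x (by positivity))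
            (enorm_average_sub_average_pow_le hf x ht k))
    _ ≤ 1 * (ENNReal.ofReal (2 ^ n) * bmoNorm f) + k * (ENNReal.ofReal (2 ^ n) * bmoNorm f) := by
        gcongr; rw [one_mul]; exact le_mul_of_one_le_left' h2
    _ = _ := by ring

/-! ### The Poisson-type majorant -/

/-- The weight `t (t + u)^{-(n+1)} = t⁻ⁿ (1 + u / t)^{-(n+1)}`, which dominates the dilations
`φ_t` of a Schwartz function at points of norm `u`. -/
noncomputable def poissonWeight (n : ℕ) (t u : ℝ) : ℝ := t / (t + u) ^ (n + 1)

theorem poissonWeight_nonneg (n : ℕ) {t u : ℝ} (ht : 0 < t) (hu : 0 ≤ u) :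
    0 ≤ poissonWeight n t u := by
  unfold poissonWeight; positivity

theorem measurable_poissonWeight {n : ℕ} (t : ℝ) (x : Eucl n) :
    Measurable fun z : Eucl n => ENNReal.ofReal (poissonWeight n t ‖x - z‖) := by
  unfold poissonWeight; fun_prop

/-- The weight is dominated by a superposition of normalized indicators of the balls of radius
`2ᵏ t`. -/
theorem poissonWeight_le_tsum {n : ℕ} {t : ℝ} (ht : 0 < t) (x z : Eucl n) :
    ENNReal.ofReal (poissonWeight n t ‖x - z‖) ≤
      ∑' k : ℕ, (ball x (2 ^ k * t)).indicator
        (fun _ => ENNReal.ofReal (2 ^ (n + 1) * (2 ^ k)⁻¹ * ((2 ^ k * t) ^ n)⁻¹)) z := by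
  classical
  have hex : ∃ k : ℕ, ‖x - z‖ < 2 ^ k * t := by
    obtain ⟨k, hk⟩ := pow_unbounded_of_one_lt (‖x - z‖ / t) one_lt_two
    exact ⟨k, (div_lt_iff₀ ht).1 hk⟩
  set k := Nat.find hex with hk
  have h1 : ‖x - z‖ < 2 ^ k * t := Nat.find_spec hex
  have h2 : 2 ^ k * t / 2 ≤ t + ‖x - z‖ := by
    rcases Nat.eq_zero_or_pos k with h0 | h0
    · rw [h0]; have := norm_nonneg (x - z); linarith
    · obtain ⟨m, hm⟩ := Nat.exists_eq_succ_of_ne_zero h0.ne'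
      have := Nat.find_min hex (m := m) (by omega)
      rw [hm, Nat.succ_eq_add_one, pow_succ]; linarith
  refine le_trans ?_ (ENNReal.le_tsum k)
  rw [Set.indicator_of_mem (by rwa [mem_ball, dist_comm, dist_eq_norm])]
  apply ENNReal.ofReal_le_ofReal
  calc poissonWeight n t ‖x - z‖ ≤ t / (2 ^ k * t / 2) ^ (n + 1) := by
        unfold poissonWeight; gcongr
    _ = _ := by
        have : (2 : ℝ) ^ k ≠ 0 := by positivity
        field_simp
        rw [div_pow, mul_pow]
        field_simp
        ring

/-- Integration against the weight is dominated by a geometric combination of averages over the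
balls of radius `2ᵏ t`. -/
theorem lintegral_poissonWeight_mul_le {n : ℕ} {t : ℝ} (ht : 0 < t) (x : Eucl n)
    {h : Eucl n → ℝ≥0∞} (hh : AEMeasurable h) :
    ∫⁻ z, ENNReal.ofReal (poissonWeight n t ‖x - z‖) * h z ≤
      ENNReal.ofReal (2 ^ (n + 1)) * volume (ball (0 : Eucl n) 1) *
        ∑' k : ℕ, (2⁻¹ : ℝ≥0∞) ^ k * ballAvg h x (2 ^ k * t) := by
  have hc (k : ℕ) : ENNReal.ofReal (2 ^ (n + 1) * (2 ^ k)⁻¹ * ((2 ^ k * t) ^ n)⁻¹)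
      * volume (ball x (2 ^ k * t))
      = ENNReal.ofReal (2 ^ (n + 1)) * volume (ball (0 : Eucl n) 1) * (2⁻¹ : ℝ≥0∞) ^ k := by
    have hp : 0 < (2 ^ k * t) ^ n := by positivity
    rw [volume_ball_eq x (by positivity), ← mul_assoc, ← ENNReal.ofReal_mul (by positivity),
      mul_assoc (2 ^ (n + 1) * (2 ^ k)⁻¹ : ℝ), inv_mul_cancel₀ hp.ne', mul_one,
      ENNReal.ofReal_mul (by positivity), ENNReal.ofReal_inv_of_pos (by positivity),
      ENNReal.ofReal_pow (by norm_num) k, ENNReal.ofReal_ofNat, ENNReal.inv_pow]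
    ring
  calc _ ≤ ∫⁻ z, ∑' k : ℕ, (ball x (2 ^ k * t)).indicator
        (fun z => ENNReal.ofReal (2 ^ (n + 1) * (2 ^ k)⁻¹ * ((2 ^ k * t) ^ n)⁻¹) * h z) z := by
        refine lintegral_mono fun z => ?_
        refine (mul_le_mul_left (poissonWeight_le_tsum ht x z) _).trans ?_
        rw [← ENNReal.tsum_mul_right]
        refine ENNReal.tsum_le_tsum fun k => ?_
        by_cases hz : z ∈ ball x (2 ^ k * t)
        · simp only [Set.indicator_of_mem hz]; exact le_rfl
        · simp only [Set.indicator_of_notMem hz]; simp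
    _ = _ := by
        rw [lintegral_tsum fun k => (hh.const_mul _).indicator measurableSet_ball,
          ← ENNReal.tsum_mul_left]
        congr 1; ext k
        rw [lintegral_indicator measurableSet_ball, lintegral_const_mul'' _ hh.restrict,
          lintegral_ball_eq h x (by positivity), ← mul_assoc, hc, mul_assoc]

/-- The constant `2^{n+1} |B(0,1)|`. -/
noncomputable def weightConst (n : ℕ) : ℝ≥0∞ :=
  ENNReal.ofReal (2 ^ (n + 1)) * volume (ball (0 : Eucl n) 1)

theorem weightConst_ne_top (n : ℕ) : weightConst n ≠ ∞ :=
  ENNReal.mul_ne_top ENNReal.ofReal_ne_top (volume_ball_ne_top _ _)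

theorem tsum_succ_mul_two_inv_pow_le :
    ∑' k : ℕ, (2⁻¹ : ℝ≥0∞) ^ k * (k + 1) ≤ 4 := by
  have h : HasSum (fun k : ℕ => (k + 1 : ℝ) * (1 / 2) ^ k) 4 := by
    have h1 := hasSum_coe_mul_geometric_of_norm_lt_one (r := (1 / 2 : ℝ)) (by norm_num)
    have h2 := hasSum_geometric_of_lt_one (r := (1 / 2 : ℝ)) (by norm_num) (by norm_num)
    have e1 : (fun k : ℕ => (k + 1 : ℝ) * (1 / 2) ^ k)
        = fun k : ℕ => (k : ℝ) * (1 / 2) ^ k + (1 / 2) ^ k := by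
      funext k; ring
    have e2 : (4 : ℝ) = 1 / 2 / (1 - 1 / 2) ^ 2 + (1 - 1 / 2)⁻¹ := by norm_num
    rw [e1, e2]
    exact h1.add h2
  have h3 : ∑' k : ℕ, (2⁻¹ : ℝ≥0∞) ^ k * (k + 1)
      = ∑' k : ℕ, ENNReal.ofReal ((k + 1 : ℝ) * (1 / 2) ^ k) := by
    congr 1; ext k
    rw [ENNReal.ofReal_mul (by positivity), ENNReal.ofReal_pow (by positivity), one_div,
      ENNReal.ofReal_inv_of_pos two_pos, ENNReal.ofReal_add (by positivity) zero_le_one]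
    simp [mul_comm]
  rw [h3, ← ENNReal.ofReal_tsum_of_nonneg (fun k => by positivity) h.summable, h.tsum_eq]
  simp

/-- A function of bounded mean oscillation, recentred on `B(x, t)`, integrates against the weight
at scale `t`. -/
theorem lintegral_poissonWeight_bmo_le {n : ℕ} {f : Eucl n → ℂ} (hf : LocallyIntegrable f)
    {t : ℝ} (ht : 0 < t) (x : Eucl n) :
    ∫⁻ z, ENNReal.ofReal (poissonWeight n t ‖x - z‖) * ‖f z - ⨍ y in ball x t, f y‖ₑ ≤
      weightConst n * (4 * ENNReal.ofReal (2 ^ n)) * bmoNorm f := by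
  refine (lintegral_poissonWeight_mul_le ht x
    (hf.aestronglyMeasurable.sub aestronglyMeasurable_const).enorm).trans ?_
  rw [mul_assoc (weightConst n), ← weightConst]
  gcongr
  calc _ ≤ ∑' k : ℕ, (2⁻¹ : ℝ≥0∞) ^ k * (k + 1) * (ENNReal.ofReal (2 ^ n) * bmoNorm f) := by
        refine ENNReal.tsum_le_tsum fun k => ?_
        rw [mul_assoc]
        gcongr
        exact ballAvg_pow_le hf x ht k
    _ ≤ 4 * (ENNReal.ofReal (2 ^ n) * bmoNorm f) := by
        rw [ENNReal.tsum_mul_right]; gcongr; exact tsum_succ_mul_two_inv_pow_le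
    _ = _ := by ring

/-- The total mass of the weight. -/
theorem lintegral_poissonWeight_le {n : ℕ} {t : ℝ} (ht : 0 < t) (x : Eucl n) :
    ∫⁻ z, ENNReal.ofReal (poissonWeight n t ‖x - z‖) ≤ weightConst n * 2 := by
  have := lintegral_poissonWeight_mul_le ht x (h := fun _ => 1) aemeasurable_const
  simp only [mul_one] at this
  refine this.trans (le_of_eq ?_)
  rw [weightConst]
  congr 1
  rw [tsum_congr fun k => by rw [ballAvg_const _ _ (by positivity), mul_one],
    ENNReal.tsum_geometric, ENNReal.one_sub_inv_two, inv_inv]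

/-! ### The Hardy–Littlewood maximal function -/

/-- The centred Hardy–Littlewood maximal function of a nonnegative function. -/
noncomputable def hlMax {n : ℕ} (h : Eucl n → ℝ≥0∞) (x : Eucl n) : ℝ≥0∞ :=
  ⨆ (r : ℝ) (_ : 0 < r), ballAvg h x r

theorem ballAvg_le_hlMax {n : ℕ} (h : Eucl n → ℝ≥0∞) (x : Eucl n) {r : ℝ} (hr : 0 < r) :
    ballAvg h x r ≤ hlMax h x := le_iSup_of_le r (le_iSup_of_le hr le_rfl)

theorem exists_radius_of_lt_hlMax {n : ℕ} {h : Eucl n → ℝ≥0∞} {x : Eucl n} {l : ℝ≥0∞}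
    (hx : l < hlMax h x) : ∃ r : ℝ, 0 < r ∧ l < ballAvg h x r := by
  simpa [hlMax, lt_iSup_iff] using hx

theorem mul_volume_le_of_lt_ballAvg {n : ℕ} {h : Eucl n → ℝ≥0∞} {x : Eucl n} {l : ℝ≥0∞} {r : ℝ}
    (hr : 0 < r) (hl : l ≤ ballAvg h x r) :
    l * volume (ball x r) ≤ ∫⁻ z in ball x r, h z := by
  rw [lintegral_ball_eq h x hr, mul_comm]; gcongr

/-- The radii of the balls on which an integrable function has a large average are bounded. -/
theorem exists_radius_bound {n : ℕ} (hn : 1 ≤ n) {h : Eucl n → ℝ≥0∞} (hh : ∫⁻ z, h z ≠ ∞)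
    {l : ℝ≥0∞} (hl : l ≠ 0) :
    ∃ R : ℝ, ∀ (x : Eucl n) (r : ℝ), 0 < r → l < ballAvg h x r → r ≤ R := by
  set ω := volume (ball (0 : Eucl n) 1) with hω
  have hω0 : ω ≠ 0 := volume_ball_ne_zero _ one_pos
  refine ⟨max 1 ((∫⁻ z, h z) / (l * ω)).toReal, fun x r hr hlr => ?_⟩
  rcases le_total r 1 with h1 | h1
  · exact le_max_of_le_left h1
  refine le_max_of_le_right ?_
  have h2 := (mul_volume_le_of_lt_ballAvg hr hlr.le).trans (setLIntegral_le_lintegral _ _)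
  rw [volume_ball_eq x hr, ← hω, mul_comm (ENNReal.ofReal _), ← mul_assoc] at h2
  have h3 : ENNReal.ofReal (r ^ n) ≤ (∫⁻ z, h z) / (l * ω) := by
    rw [ENNReal.le_div_iff_mul_le (Or.inl (mul_ne_zero hl hω0))
      (Or.inl (ENNReal.mul_ne_top hlr.ne_top (volume_ball_ne_top _ _))), mul_comm]
    exact h2
  have h4 := (ENNReal.ofReal_le_iff_le_toReal
    (ENNReal.div_ne_top hh (mul_ne_zero hl hω0))).1 h3
  exact (le_self_pow₀ h1 (by omega)).trans h4

/-- Calderón–Zygmund stopping balls: a set of points where the maximal function of `h` exceeds `l`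
is covered by the fivefold dilates of disjoint balls on which the average of `h` exceeds `l`, and
whose concentric balls of at least twice the radius have average at most `l`. -/
theorem exists_stopping_balls {n : ℕ} (hn : 1 ≤ n) {h : Eucl n → ℝ≥0∞} (hh : ∫⁻ z, h z ≠ ∞)
    {l : ℝ≥0∞} (hl : l ≠ 0) {S : Set (Eucl n)} (hS : ∀ x ∈ S, l < hlMax h x) :
    ∃ (u : Set (Eucl n)) (r : Eucl n → ℝ), u ⊆ S ∧ u.Countable ∧
      (∀ x ∈ u, 0 < r x ∧ l < ballAvg h x (r x) ∧ ∀ s, 2 * r x ≤ s → ballAvg h x s ≤ l) ∧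
      l * (∑' x : u, volume (ball (x : Eucl n) (r x))) ≤ ∫⁻ z, h z ∧
      S ⊆ ⋃ x : u, ball (x : Eucl n) (5 * r x) := by
  obtain ⟨R, hR⟩ := exists_radius_bound hn hh hl
  have hex : ∀ x ∈ S, ∃ r : ℝ, 0 < r ∧ l < ballAvg h x r ∧
      ∀ s, 2 * r ≤ s → ballAvg h x s ≤ l := by
    intro x hx
    set T : Set ℝ := {r | 0 < r ∧ l < ballAvg h x r} with hT
    have hne : T.Nonempty := exists_radius_of_lt_hlMax (hS x hx)
    have hb : BddAbove T := ⟨R, fun r hr => hR x r hr.1 hr.2⟩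
    have hpos : 0 < sSup T := by
      obtain ⟨r, hr⟩ := hne
      exact hr.1.trans_le (le_csSup hb hr)
    obtain ⟨r, hr, hr2⟩ := exists_lt_of_lt_csSup hne (half_lt_self hpos)
    refine ⟨r, hr.1, hr.2, fun s hs => ?_⟩
    by_contra! hcon
    have : s ∈ T := ⟨by linarith [hr.1], hcon⟩
    linarith [le_csSup hb this]
  choose! r hr using hex
  obtain ⟨u, huS, hdisj, hcov⟩ := Vitali.exists_disjoint_subfamily_covering_enlargement_ball
    S id r R (fun x hx => hR x _ (hr x hx).1 (hr x hx).2.1) 5 (by norm_num)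
  have hcount : u.Countable := hdisj.countable_of_isOpen (fun x _ => isOpen_ball)
    (fun x hx => ⟨x, mem_ball_self (hr x (huS hx)).1⟩)
  refine ⟨u, r, huS, hcount, fun x hx => hr x (huS hx), ?_, ?_⟩
  · have : Countable u := hcount.to_subtype
    calc _ = ∑' x : u, l * volume (ball (x : Eucl n) (r x)) := ENNReal.tsum_mul_left.symm
      _ ≤ ∑' x : u, ∫⁻ z in ball (x : Eucl n) (r x), h z := ENNReal.tsum_le_tsum fun x =>
          mul_volume_le_of_lt_ballAvg (hr x (huS x.2)).1 (hr x (huS x.2)).2.1.le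
      _ = ∫⁻ z in ⋃ x : u, ball (x : Eucl n) (r x), h z :=
          (lintegral_iUnion (s := fun x : u => ball (x : Eucl n) (r x))
            (fun _ => measurableSet_ball) (fun (x y : u) hxy => hdisj x.2 y.2 (Subtype.coe_injective.ne hxy)) _).symm
      _ ≤ _ := setLIntegral_le_lintegral _ _
  · intro x hx
    obtain ⟨b, hb, hsub⟩ := hcov x hx
    exact Set.mem_iUnion.2 ⟨⟨b, hb⟩, hsub (mem_ball_self (hr x hx).1)⟩

/-- The weak type `(1, 1)` inequality for the maximal function. -/
theorem mul_volume_hlMax_gt_le {n : ℕ} (hn : 1 ≤ n) {h : Eucl n → ℝ≥0∞} (hh : ∫⁻ z, h z ≠ ∞)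
    {l : ℝ≥0∞} (hl : l ≠ 0) :
    l * volume {x | l < hlMax h x} ≤ ENNReal.ofReal (5 ^ n) * ∫⁻ z, h z := by
  obtain ⟨u, r, -, hc, hr, hsum, hcov⟩ :=
    exists_stopping_balls hn hh hl (S := {x | l < hlMax h x}) (fun x hx => hx)
  have : Countable u := hc.to_subtype
  calc _ ≤ l * ∑' x : u, volume (ball (x : Eucl n) (5 * r x)) := by
        gcongr; exact (measure_mono hcov).trans (measure_iUnion_le _)
    _ = l * ∑' x : u, ENNReal.ofReal (5 ^ n) * volume (ball (x : Eucl n) (r x)) := by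
        congr 2; ext x; exact volume_ball_mul _ _ (by norm_num) (hr x x.2).1
    _ = ENNReal.ofReal (5 ^ n) * (l * ∑' x : u, volume (ball (x : Eucl n) (r x))) := by
        rw [ENNReal.tsum_mul_left]; ring
    _ ≤ _ := by gcongr

/-- Lebesgue differentiation: an integrable function is dominated by its maximal function. -/
theorem ae_le_hlMax {n : ℕ} {h : Eucl n → ℝ≥0∞} (hm : AEMeasurable h) (hh : ∫⁻ z, h z ≠ ∞) :
    ∀ᵐ x, h x ≤ hlMax h x := by
  filter_upwards [(Besicovitch.vitaliFamily (volume : Measure (Eucl n))).ae_tendsto_lintegral_div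
    hm hh] with x hx
  have h1 := hx.comp (Besicovitch.tendsto_filterAt (volume : Measure (Eucl n)) x)
  refine le_of_tendsto h1 ?_
  filter_upwards [self_mem_nhdsWithin] with r hr
  have hr : 0 < r := hr
  refine le_trans (le_of_eq ?_) (ballAvg_le_hlMax h x hr)
  have hae : (closedBall x r : Set (Eucl n)) =ᵐ[volume] ball x r := by
    rw [← ball_union_sphere]
    exact union_ae_eq_left_of_ae_eq_empty (by
      rw [ae_eq_empty]; exact Measure.addHaar_sphere_of_ne_zero _ x hr.ne')
  simp only [Function.comp]
  rw [setLIntegral_congr hae, measure_congr hae, ballAvg, ENNReal.div_eq_inv_mul]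

theorem lintegral_Ioo_two_mul (a : ℝ) (ha : 0 ≤ a) :
    ∫⁻ s in Set.Ioo 0 a, ENNReal.ofReal (2 * s) = ENNReal.ofReal (a ^ 2) := by
  rw [← ofReal_integral_eq_lintegral_ofReal, ← integral_Ioc_eq_integral_Ioo,
    ← intervalIntegral.integral_of_le ha]
  · congr 1
    rw [intervalIntegral.integral_const_mul, integral_id]; ring
  · exact (continuous_const.mul continuous_id).integrableOn_Icc.mono_set Set.Ioo_subset_Icc_self
  · filter_upwards [ae_restrict_mem measurableSet_Ioo] with s hs
    exact mul_nonneg zero_le_two hs.1.le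

theorem sq_le_lintegral_layer (g : ℝ≥0∞) :
    g ^ 2 ≤ ∫⁻ s in Set.Ioi (0 : ℝ), if ENNReal.ofReal s < g then ENNReal.ofReal (2 * s) else 0 := by
  have key : ∀ a : ℝ, 0 ≤ a → ENNReal.ofReal a ≤ g → ENNReal.ofReal a ^ 2 ≤
      ∫⁻ s in Set.Ioi (0 : ℝ), if ENNReal.ofReal s < g then ENNReal.ofReal (2 * s) else 0 := by
    intro a ha hag
    rw [← ENNReal.ofReal_pow ha, ← lintegral_Ioo_two_mul a ha]
    calc _ = ∫⁻ s in Set.Ioo 0 a, if ENNReal.ofReal s < g then ENNReal.ofReal (2 * s) else 0 := by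
          refine setLIntegral_congr_fun measurableSet_Ioo fun s hs => ?_
          rw [if_pos]
          exact ((ENNReal.ofReal_lt_ofReal_iff (hs.1.trans hs.2)).2 hs.2).trans_le hag
      _ ≤ _ := lintegral_mono_set Set.Ioo_subset_Ioi_self
  by_cases hg : g = ∞
  · rw [hg] at key ⊢
    refine le_trans (b := ∞) (le_of_eq (by simp)) (le_of_forall_lt fun b hb => ?_)
    have hb' : ENNReal.ofReal (b.toReal + 1) ≤ ENNReal.ofReal (b.toReal + 1) ^ 2 := by
      refine le_self_pow₀ ?_ two_ne_zero
      rw [ENNReal.one_le_ofReal]; linarith [ENNReal.toReal_nonneg (a := b)]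
    refine lt_of_lt_of_le ?_ (hb'.trans (key (b.toReal + 1) (by positivity) le_top))
    rw [ENNReal.lt_ofReal_iff_toReal_lt hb.ne]; linarith
  · have := key g.toReal ENNReal.toReal_nonneg (by rw [ENNReal.ofReal_toReal hg])
    rwa [ENNReal.ofReal_toReal hg] at this

/-- The `L²` boundedness of the maximal function, stated for its measurable minorants. -/
theorem lintegral_sq_le_of_le_hlMax {n : ℕ} (hn : 1 ≤ n) {h G : Eucl n → ℝ≥0∞}
    (hm : Measurable h) (hG : Measurable G) (hle : ∀ x, G x ≤ hlMax h x) :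
    ∫⁻ x, G x ^ 2 ≤ ENNReal.ofReal (8 * 5 ^ n) * ∫⁻ x, h x ^ 2 := by
  by_cases hfin : ∫⁻ x, h x ^ 2 = ∞
  · rw [hfin, ENNReal.mul_top]
    · exact le_top
    · simp
  -- the part of `h` above height `s / 2` is integrable and controls `{G > s}`
  have hlevel : ∀ s : ℝ, 0 < s → ENNReal.ofReal (2 * s) * volume {x | ENNReal.ofReal s < G x} ≤
      ∫⁻ x, if ENNReal.ofReal s < 2 * h x then ENNReal.ofReal (4 * 5 ^ n) * h x else 0 := by
    intro s hs
    set l := ENNReal.ofReal (s / 2) with hl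
    have hl0 : l ≠ 0 := by rw [hl]; simpa using hs
    have hls : ENNReal.ofReal s = 2 * l := by
      rw [hl, ← ENNReal.ofReal_ofNat, ← ENNReal.ofReal_mul zero_le_two]; congr 1; ring
    have hiff : ∀ x, ENNReal.ofReal s < 2 * h x ↔ l < h x := fun x => by
      rw [hls, ENNReal.mul_lt_mul_iff_right two_ne_zero ENNReal.ofNat_ne_top]
    set k : Eucl n → ℝ≥0∞ := fun x => if l < h x then h x else 0 with hk
    have hkfin : ∫⁻ x, k x ≠ ∞ := by
      refine ne_top_of_le_ne_top (b := l⁻¹ * ∫⁻ x, h x ^ 2)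
        (ENNReal.mul_ne_top (ENNReal.inv_ne_top.2 hl0) hfin) ?_
      rw [← lintegral_const_mul _ (hm.pow_const 2)]
      refine lintegral_mono fun x => ?_
      simp only [hk]
      split_ifs with hx
      · calc h x = (l⁻¹ * l) * h x := by
              rw [ENNReal.inv_mul_cancel hl0 ENNReal.ofReal_ne_top, one_mul]
          _ ≤ (l⁻¹ * h x) * h x := by gcongr
          _ = _ := by ring
      · exact zero_le
    have hsub : {x | ENNReal.ofReal s < G x} ⊆ {x | l < hlMax k x} := by
      intro x hx
      obtain ⟨r, hr, hxr⟩ := exists_radius_of_lt_hlMax (lt_of_lt_of_le hx (hle x))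
      refine lt_of_lt_of_le ?_ (ballAvg_le_hlMax k x hr)
      have h1 : ballAvg h x r ≤ ballAvg k x r + l := by
        rw [← ballAvg_add_const _ _ _ hr]
        refine ballAvg_mono (fun z => ?_) x r
        simp only [hk]
        split_ifs with hz
        · exact le_self_add
        · simpa using hz
      rw [hls, two_mul] at hxr
      exact (ENNReal.add_lt_add_iff_right ENNReal.ofReal_ne_top).1 (hxr.trans_le h1)
    have h4 : ENNReal.ofReal (2 * s) = 4 * l := by
      rw [ENNReal.ofReal_mul zero_le_two, hls, ENNReal.ofReal_ofNat, ← mul_assoc]; norm_num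
    calc _ ≤ 4 * (l * volume {x | l < hlMax k x}) := by
          rw [h4, mul_assoc]; gcongr
      _ ≤ 4 * (ENNReal.ofReal (5 ^ n) * ∫⁻ x, k x) := by
          exact mul_le_mul' le_rfl (mul_volume_hlMax_gt_le hn hkfin hl0)
      _ = ENNReal.ofReal (4 * 5 ^ n) * ∫⁻ x, k x := by
          rw [ENNReal.ofReal_mul (by norm_num), ENNReal.ofReal_ofNat, mul_assoc]
      _ = ∫⁻ x, ENNReal.ofReal (4 * 5 ^ n) * k x :=
          (lintegral_const_mul' _ _ ENNReal.ofReal_ne_top).symm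
      _ = _ := by
          refine lintegral_congr fun x => ?_
          simp only [hk, hiff, mul_ite, mul_zero]
  calc ∫⁻ x, G x ^ 2 ≤ ∫⁻ x, ∫⁻ s in Set.Ioi (0 : ℝ),
        if ENNReal.ofReal s < G x then ENNReal.ofReal (2 * s) else 0 :=
        lintegral_mono fun x => sq_le_lintegral_layer _
    _ = ∫⁻ s in Set.Ioi (0 : ℝ), ∫⁻ x,
        if ENNReal.ofReal s < G x then ENNReal.ofReal (2 * s) else 0 := by
        refine lintegral_lintegral_swap (Measurable.aemeasurable ?_)
        exact Measurable.ite (measurableSet_lt (by fun_prop) (hG.comp measurable_fst))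
          (by fun_prop) measurable_const
    _ = ∫⁻ s in Set.Ioi (0 : ℝ),
        ENNReal.ofReal (2 * s) * volume {x | ENNReal.ofReal s < G x} := by
        refine lintegral_congr fun s => ?_
        have : (fun x => if ENNReal.ofReal s < G x then ENNReal.ofReal (2 * s) else 0)
            = {x | ENNReal.ofReal s < G x}.indicator fun _ => ENNReal.ofReal (2 * s) := by
          ext x; simp [Set.indicator]
        rw [this, lintegral_indicator_const (measurableSet_lt measurable_const hG)]
    _ ≤ ∫⁻ s in Set.Ioi (0 : ℝ), ∫⁻ x,
        if ENNReal.ofReal s < 2 * h x then ENNReal.ofReal (4 * 5 ^ n) * h x else 0 :=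
        setLIntegral_mono' measurableSet_Ioi fun s hs => hlevel s hs
    _ = ∫⁻ x, ∫⁻ s in Set.Ioi (0 : ℝ),
        if ENNReal.ofReal s < 2 * h x then ENNReal.ofReal (4 * 5 ^ n) * h x else 0 := by
        refine lintegral_lintegral_swap (Measurable.aemeasurable ?_)
        exact Measurable.ite (measurableSet_lt (by fun_prop) (by fun_prop)) (by fun_prop)
          measurable_const
    _ ≤ ∫⁻ x, ENNReal.ofReal (8 * 5 ^ n) * h x ^ 2 := by
        refine lintegral_mono fun x => ?_
        have h1 : (fun s : ℝ => if ENNReal.ofReal s < 2 * h x then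
            ENNReal.ofReal (4 * 5 ^ n) * h x else 0)
            = {s : ℝ | ENNReal.ofReal s < 2 * h x}.indicator
              fun _ => ENNReal.ofReal (4 * 5 ^ n) * h x := by
          ext x; simp [Set.indicator]
        have hmeas : MeasurableSet {s : ℝ | ENNReal.ofReal s < 2 * h x} :=
          measurableSet_lt (by fun_prop) measurable_const
        have h2 : (volume.restrict (Set.Ioi 0)) {s : ℝ | ENNReal.ofReal s < 2 * h x}
            ≤ 2 * h x := by
          by_cases hx : h x = ∞
          · simp [hx]
          rw [Measure.restrict_apply hmeas]
          calc _ ≤ volume (Set.Ioo 0 (2 * h x).toReal) := by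
                refine measure_mono fun s hs => ⟨hs.2, ?_⟩
                have := hs.1
                exact (ENNReal.ofReal_lt_iff_lt_toReal (le_of_lt hs.2)
                  (ENNReal.mul_ne_top ENNReal.ofNat_ne_top hx)).1 this
            _ = _ := by
                rw [Real.volume_Ioo, sub_zero,
                  ENNReal.ofReal_toReal (ENNReal.mul_ne_top ENNReal.ofNat_ne_top hx)]
        rw [h1, lintegral_indicator_const hmeas]
        calc _ ≤ ENNReal.ofReal (4 * 5 ^ n) * h x * (2 * h x) := by gcongr
          _ = _ := by
            rw [show (8 * 5 ^ n : ℝ) = 2 * (4 * 5 ^ n) by ring, ENNReal.ofReal_mul zero_le_two,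
              ENNReal.ofReal_ofNat]
            ring
    _ = _ := lintegral_const_mul _ (hm.pow_const 2)

/-! ### The `L²` form of the John–Nirenberg inequality -/

theorem ENNReal.add_sq_le_four_mul (a b : ℝ≥0∞) : (a + b) ^ 2 ≤ 4 * (a ^ 2 + b ^ 2) := by
  wlog h : a ≤ b generalizing a b
  · rw [add_comm a, add_comm (a ^ 2)]; exact this b a (le_of_not_ge h)
  calc (a + b) ^ 2 ≤ (b + b) ^ 2 := by gcongr
    _ = 4 * b ^ 2 := by ring
    _ ≤ _ := by gcongr; exact le_add_self

/-- The stopping height `16 · 20ⁿ ‖f‖_BMO`. -/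
noncomputable def stopHeight {n : ℕ} (f : Eucl n → ℂ) : ℝ≥0∞ := 2 * 4 ^ n * (8 * 5 ^ n) * bmoNorm f

theorem ofReal_ofNat_pow (m n : ℕ) [m.AtLeastTwo] :
    ENNReal.ofReal ((OfNat.ofNat m : ℝ) ^ n) = (OfNat.ofNat m : ℝ≥0∞) ^ n := by
  rw [ENNReal.ofReal_pow (Nat.ofNat_nonneg m), ENNReal.ofReal_ofNat]

/-- Self-improvement of a bound `A` for the mean square oscillation: outside stopping balls of
small total measure the function is within the stopping height of its average, and on each of
them `A` applies. -/
theorem two_mul_ballAvg_sq_le {n : ℕ} (hn : 1 ≤ n) {f : Eucl n → ℂ} (hf : LocallyIntegrable f)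
    (hb0 : bmoNorm f ≠ 0) (hb : bmoNorm f ≠ ∞) {A : ℝ≥0∞}
    (hA : ∀ (c : Eucl n) (r : ℝ), 0 < r →
      ballAvg (fun x => ‖f x - ⨍ y in ball c r, f y‖ₑ ^ 2) c r ≤ A)
    (c : Eucl n) {r : ℝ} (hr : 0 < r) :
    2 * ballAvg (fun x => ‖f x - ⨍ y in ball c r, f y‖ₑ ^ 2) c r ≤ 3 * stopHeight f ^ 2 + A := by
  set a := ⨍ y in ball c r, f y with ha
  set l := stopHeight f with hl
  have hl0 : l ≠ 0 := by simp [hl, stopHeight, hb0]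
  have hm : AEMeasurable (fun z => ‖f z - a‖ₑ) :=
    (hf.aestronglyMeasurable.sub aestronglyMeasurable_const).enorm
  set h : Eucl n → ℝ≥0∞ := (ball c (2 * r)).indicator fun z => ‖f z - a‖ₑ with hh
  have hhint : ∫⁻ z, h z ≤ 2 * 4 ^ n * bmoNorm f * volume (ball c r) := by
    rw [hh, lintegral_indicator measurableSet_ball,
      lintegral_ball_eq _ _ (by positivity), volume_ball_mul c c two_pos hr, ofReal_ofNat_pow]
    have := ballAvg_pow_le hf c hr 1
    rw [pow_one, ofReal_ofNat_pow, ← ha] at this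
    calc _ ≤ 2 ^ n * volume (ball c r) * (((1 : ℕ) + 1) * (2 ^ n * bmoNorm f)) := by gcongr
      _ = _ := by
        rw [show (4 : ℝ≥0∞) = 2 * 2 by norm_num, mul_pow]; push_cast; ring
  have hhfin : ∫⁻ z, h z ≠ ∞ := ne_top_of_le_ne_top
    (ENNReal.mul_ne_top (ENNReal.mul_ne_top (by finiteness) hb) (volume_ball_ne_top c r)) hhint
  obtain ⟨u, ρ, huS, huc, hu, hsum, hcov⟩ := exists_stopping_balls hn hhfin hl0
    (S := {x | x ∈ ball c r ∧ l < hlMax h x}) (fun x hx => hx.2)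
  have : Countable u := huc.to_subtype
  have hsmall : 8 * 5 ^ n * ∑' x : u, volume (ball (x : Eucl n) (ρ x)) ≤ volume (ball c r) := by
    have h1 := hsum.trans hhint
    rw [hl, stopHeight, show ∀ s v : ℝ≥0∞, 2 * 4 ^ n * (8 * 5 ^ n) * bmoNorm f * s
      ≤ 2 * 4 ^ n * bmoNorm f * v ↔ 2 * 4 ^ n * bmoNorm f * (8 * 5 ^ n * s)
      ≤ 2 * 4 ^ n * bmoNorm f * v from fun s v => by ring_nf] at h1
    rwa [ENNReal.mul_le_mul_iff_right (by simp [hb0])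
      (ENNReal.mul_ne_top (by finiteness) hb)] at h1
  have hball : ∀ x : u, ∫⁻ z in ball (x : Eucl n) (5 * ρ x), ‖f z - a‖ₑ ^ 2
      ≤ 4 * 5 ^ n * (A + l ^ 2) * volume (ball (x : Eucl n) (ρ x)) := by
    intro x
    obtain ⟨hρ, -, hlow⟩ := hu x x.2
    have hρr : 5 * ρ x ≤ r := by
      by_contra! hcon
      have h1 : volume (ball c r) ≤ 5 ^ n * volume (ball (x : Eucl n) (ρ x)) := by
        rw [← ofReal_ofNat_pow, ← volume_ball_mul c _ (by norm_num) hρ]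
        exact measure_mono (ball_subset_ball hcon.le)
      have h2 : 8 * 5 ^ n * volume (ball (x : Eucl n) (ρ x)) ≤ volume (ball c r) :=
        le_trans (by gcongr; exact ENNReal.le_tsum x) hsmall
      have h3 : 5 ^ n * volume (ball (x : Eucl n) (ρ x)) ≠ 0 :=
        mul_ne_zero (by positivity) (volume_ball_ne_zero _ hρ)
      have h4 : 5 ^ n * volume (ball (x : Eucl n) (ρ x)) ≠ ∞ :=
        ENNReal.mul_ne_top (by finiteness) (volume_ball_ne_top _ _)
      have h5 := h2.trans h1
      rw [mul_assoc] at h5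
      have h6 : (8 : ℝ≥0∞) ≤ 1 := by
        rwa [← ENNReal.mul_le_mul_iff_left h3 h4, one_mul]
      norm_num at h6
    have hsub : ball (x : Eucl n) (5 * ρ x) ⊆ ball c (2 * r) := by
      apply ball_subset_ball'
      have := mem_ball.1 (huS x.2).1
      linarith
    have h5ρ : 0 < 5 * ρ x := by positivity
    set b := ⨍ y in ball (x : Eucl n) (5 * ρ x), f y with hb'
    have hba : ‖b - a‖ₑ ≤ l := by
      refine (enorm_average_sub_le hf a _ h5ρ).trans (le_trans (le_of_eq ?_)
        (hlow (5 * ρ x) (by linarith)))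
      rw [ballAvg, ballAvg]
      congr 1
      refine setLIntegral_congr_fun measurableSet_ball fun z hz => ?_
      rw [hh, Set.indicator_of_mem (hsub hz)]
    rw [lintegral_ball_eq _ _ h5ρ, volume_ball_mul _ (x : Eucl n) (by norm_num) hρ,
      ofReal_ofNat_pow]
    have hav : ballAvg (fun z => ‖f z - a‖ₑ ^ 2) x (5 * ρ x) ≤ 4 * (A + l ^ 2) := by
      calc _ ≤ ballAvg (fun z => 4 * ‖f z - b‖ₑ ^ 2 + 4 * l ^ 2) x (5 * ρ x) := by
            refine ballAvg_mono (fun z => ?_) _ _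
            calc ‖f z - a‖ₑ ^ 2 = ‖(f z - b) + (b - a)‖ₑ ^ 2 := by congr 2; ring
              _ ≤ (‖f z - b‖ₑ + l) ^ 2 := by
                gcongr; exact (enorm_add_le _ _).trans (by gcongr)
              _ ≤ _ := (ENNReal.add_sq_le_four_mul _ _).trans (by rw [mul_add])
        _ = 4 * ballAvg (fun z => ‖f z - b‖ₑ ^ 2) x (5 * ρ x) + 4 * l ^ 2 := by
            rw [ballAvg_add_const _ _ _ h5ρ, ballAvg, lintegral_const_mul' _ _ (by finiteness),
              ballAvg]
            ring
        _ ≤ 4 * A + 4 * l ^ 2 := by gcongr; exact hA _ _ h5ρ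
        _ = _ := by ring
    calc _ ≤ 5 ^ n * volume (ball (x : Eucl n) (ρ x)) * (4 * (A + l ^ 2)) := by gcongr
      _ = _ := by ring
  set U : Set (Eucl n) := ⋃ x : u, ball (x : Eucl n) (5 * ρ x) with hU
  have hUm : MeasurableSet U := MeasurableSet.iUnion fun _ => measurableSet_ball
  have hUint : 2 * ∫⁻ z in U, ‖f z - a‖ₑ ^ 2 ≤ (A + l ^ 2) * volume (ball c r) := by
    calc _ ≤ 2 * ∑' x : u, 4 * 5 ^ n * (A + l ^ 2) * volume (ball (x : Eucl n) (ρ x)) := by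
          gcongr
          exact (lintegral_iUnion_le _ _).trans (ENNReal.tsum_le_tsum hball)
      _ = (A + l ^ 2) * (8 * 5 ^ n * ∑' x : u, volume (ball (x : Eucl n) (ρ x))) := by
          rw [ENNReal.tsum_mul_left]; ring
      _ ≤ _ := by gcongr
  have hint : ∫⁻ z in ball c r, ‖f z - a‖ₑ ^ 2
      ≤ l ^ 2 * volume (ball c r) + ∫⁻ z in U, ‖f z - a‖ₑ ^ 2 := by
    calc _ ≤ ∫⁻ z in ball c r, (l ^ 2 + U.indicator (fun z => ‖f z - a‖ₑ ^ 2) z) := by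
          refine lintegral_mono_ae ?_
          filter_upwards [ae_restrict_mem measurableSet_ball,
            ae_restrict_of_ae (ae_le_hlMax (hm.indicator measurableSet_ball) hhfin)] with z hz hz2
          by_cases hzU : z ∈ U
          · rw [Set.indicator_of_mem hzU]; exact le_add_self
          · have h1 : ¬ l < hlMax h z := fun hlt => hzU (hcov ⟨hz, hlt⟩)
            rw [Set.indicator_of_mem (ball_subset_ball (by linarith) hz)] at hz2
            refine le_add_right ?_
            gcongr
            exact hz2.trans (not_lt.1 h1)
      _ = l ^ 2 * volume (ball c r)
          + ∫⁻ z in ball c r, U.indicator (fun z => ‖f z - a‖ₑ ^ 2) z := by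
          rw [lintegral_add_left measurable_const, setLIntegral_const]
      _ ≤ _ := add_le_add le_rfl
          ((setLIntegral_le_lintegral _ _).trans (lintegral_indicator hUm _).le)
  calc 2 * ballAvg (fun x => ‖f x - a‖ₑ ^ 2) c r
      ≤ (volume (ball c r))⁻¹ * (2 * (l ^ 2 * volume (ball c r))
        + 2 * ∫⁻ z in U, ‖f z - a‖ₑ ^ 2) := by
        rw [ballAvg, ← mul_add, mul_left_comm]; gcongr
    _ ≤ (volume (ball c r))⁻¹ * (2 * (l ^ 2 * volume (ball c r))
        + (A + l ^ 2) * volume (ball c r)) := by gcongr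
    _ = (volume (ball c r))⁻¹ * volume (ball c r) * (3 * l ^ 2 + A) := by ring
    _ = _ := by
        rw [ENNReal.inv_mul_cancel (volume_ball_ne_zero c hr) (volume_ball_ne_top c r), one_mul]

theorem ballAvg_sq_eq_zero_of_bmoNorm_eq_zero {n : ℕ} {f : Eucl n → ℂ}
    (hf : LocallyIntegrable f) (hb : bmoNorm f = 0) (c : Eucl n) {r : ℝ} (hr : 0 < r) :
    ballAvg (fun x => ‖f x - ⨍ y in ball c r, f y‖ₑ ^ 2) c r = 0 := by
  have h1 : ballAvg (fun x => ‖f x - ⨍ y in ball c r, f y‖ₑ) c r = 0 :=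
    le_antisymm (hb ▸ ballAvg_le_bmoNorm f c hr) zero_le
  have hm : AEMeasurable (fun z => ‖f z - ⨍ y in ball c r, f y‖ₑ) :=
    (hf.aestronglyMeasurable.sub aestronglyMeasurable_const).enorm
  rw [ballAvg, mul_eq_zero] at h1 ⊢
  refine Or.inr ?_
  have h2 := h1.resolve_left (ENNReal.inv_ne_zero.2 (volume_ball_ne_top c r))
  rw [lintegral_eq_zero_iff' hm.restrict] at h2
  rw [lintegral_eq_zero_iff' (hm.pow_const 2).restrict]
  filter_upwards [h2] with z hz
  simpa using hz

theorem ballAvg_sq_le_of_bounded {n : ℕ} (hn : 1 ≤ n) {f : Eucl n → ℂ}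
    (hf : LocallyIntegrable f) (hb : bmoNorm f ≠ ∞) {M : ℝ} (hM : ∀ x, ‖f x‖ ≤ M)
    (c : Eucl n) {r : ℝ} (hr : 0 < r) :
    ballAvg (fun x => ‖f x - ⨍ y in ball c r, f y‖ₑ ^ 2) c r ≤ 3 * stopHeight f ^ 2 := by
  by_cases hb0 : bmoNorm f = 0
  · rw [ballAvg_sq_eq_zero_of_bmoNorm_eq_zero hf hb0 c hr]; exact zero_le
  set A : ℝ≥0∞ := ⨆ (c : Eucl n) (r : ℝ) (_ : 0 < r),
    ballAvg (fun x => ‖f x - ⨍ y in ball c r, f y‖ₑ ^ 2) c r with hA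
  have hle : ∀ (c : Eucl n) (r : ℝ), 0 < r →
      ballAvg (fun x => ‖f x - ⨍ y in ball c r, f y‖ₑ ^ 2) c r ≤ A :=
    fun c r hr => le_iSup_of_le c (le_iSup_of_le r (le_iSup_of_le hr le_rfl))
  have hM0 : 0 ≤ M := (norm_nonneg _).trans (hM 0)
  have hM' : ∀ x, ‖f x‖ₑ ≤ ENNReal.ofReal M := fun x => by
    rw [← ofReal_norm]; exact ENNReal.ofReal_le_ofReal (hM x)
  have hAfin : A ≠ ∞ := by
    refine ne_top_of_le_ne_top (b := (ENNReal.ofReal M + ENNReal.ofReal M) ^ 2) (by finiteness)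
      (iSup_le fun c => iSup_le fun r => iSup_le fun hr => ?_)
    rw [← ballAvg_const ((ENNReal.ofReal M + ENNReal.ofReal M) ^ 2) c hr]
    refine ballAvg_mono (fun x => ?_) c r
    gcongr
    refine (enorm_sub_le).trans (add_le_add (hM' x) ?_)
    have := enorm_average_sub_le hf 0 c hr
    simp only [sub_zero] at this
    exact this.trans ((ballAvg_mono hM' c r).trans (ballAvg_const _ c hr).le)
  have h2 : 2 * A ≤ 3 * stopHeight f ^ 2 + A := by
    rw [hA]
    simp only [ENNReal.mul_iSup]
    exact iSup_le fun c => iSup_le fun r => iSup_le fun hr =>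
      two_mul_ballAvg_sq_le hn hf hb0 hb hle c hr
  rw [two_mul] at h2
  exact (hle c r hr).trans ((ENNReal.add_le_add_iff_right hAfin).1 h2)

/-- Truncation of the real and imaginary parts of a complex number at height `M`. -/
noncomputable def clampC (M : ℝ) (z : ℂ) : ℂ := ⟨max (-M) (min M z.re), max (-M) (min M z.im)⟩

theorem abs_clamp_sub_le (M a b : ℝ) :
    |max (-M) (min M a) - max (-M) (min M b)| ≤ |a - b| :=
  (abs_max_sub_max_le_max _ _ _ _).trans (by
    rw [sub_self, abs_zero, max_eq_right (abs_nonneg _)]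
    exact (abs_min_sub_min_le_max _ _ _ _).trans (by simp))

theorem norm_clampC_sub_le (M : ℝ) (z w : ℂ) : ‖clampC M z - clampC M w‖ ≤ ‖z - w‖ := by
  rw [← sq_le_sq₀ (norm_nonneg _) (norm_nonneg _), Complex.sq_norm, Complex.sq_norm,
    Complex.normSq_apply, Complex.normSq_apply]
  have h1 := sq_le_sq.2 (abs_clamp_sub_le M z.re w.re)
  have h2 := sq_le_sq.2 (abs_clamp_sub_le M z.im w.im)
  simp only [clampC, Complex.sub_re, Complex.sub_im]
  nlinarith

theorem clampC_eq_self {M : ℝ} {z : ℂ} (hz : ‖z‖ ≤ M) : clampC M z = z := by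
  have h1 := abs_le.1 ((Complex.abs_re_le_norm z).trans hz)
  have h2 := abs_le.1 ((Complex.abs_im_le_norm z).trans hz)
  apply Complex.ext <;> simp [clampC, h1, h2]

theorem norm_clampC_le (M : ℝ) (hM : 0 ≤ M) (z : ℂ) : ‖clampC M z‖ ≤ ‖z‖ := by
  simpa [clampC_eq_self (z := 0) (by simpa using hM)] using norm_clampC_sub_le M z 0

theorem norm_clampC_le_bound (M : ℝ) (hM : 0 ≤ M) (z : ℂ) : ‖clampC M z‖ ≤ M + M := by
  refine (Complex.norm_le_abs_re_add_abs_im _).trans (add_le_add ?_ ?_) <;>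
  · simp only [clampC]
    exact abs_le.2 ⟨le_max_left _ _, max_le (by linarith) (min_le_left _ _)⟩

theorem continuous_clampC (M : ℝ) : Continuous (clampC M) :=
  (LipschitzWith.of_dist_le_mul (K := 1) fun z w => by
    simpa [dist_eq_norm] using norm_clampC_sub_le M z w).continuous

theorem locallyIntegrable_clampC {n : ℕ} {f : Eucl n → ℂ} (hf : LocallyIntegrable f) {M : ℝ}
    (hM : 0 ≤ M) : LocallyIntegrable fun x => clampC M (f x) :=
  hf.mono ((continuous_clampC M).comp_aestronglyMeasurable hf.aestronglyMeasurable)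
    (Filter.Eventually.of_forall fun x => norm_clampC_le M hM (f x))

theorem bmoNorm_clampC_le {n : ℕ} {f : Eucl n → ℂ} (hf : LocallyIntegrable f) {M : ℝ}
    (hM : 0 ≤ M) : bmoNorm (fun x => clampC M (f x)) ≤ 2 * bmoNorm f := by
  refine iSup_le fun c => iSup_le fun r => iSup_le fun hr => ?_
  set a := ⨍ y in ball c r, f y with ha
  have h1 : ballAvg (fun x => ‖clampC M (f x) - clampC M a‖ₑ) c r ≤ bmoNorm f :=
    (ballAvg_mono (fun x => by
      rw [← ofReal_norm, ← ofReal_norm]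
      exact ENNReal.ofReal_le_ofReal (norm_clampC_sub_le M _ _)) c r).trans
      (ballAvg_le_bmoNorm f c hr)
  calc _ ≤ ballAvg (fun x => ‖clampC M (f x) - clampC M a‖ₑ) c r
        + ‖clampC M a - ⨍ y in ball c r, clampC M (f y)‖ₑ :=
        ballAvg_enorm_sub_le_add (fun x => clampC M (f x)) _ _ c hr
    _ ≤ bmoNorm f + bmoNorm f := by
        gcongr
        rw [enorm_sub_rev]
        exact (enorm_average_sub_le (locallyIntegrable_clampC hf hM) _ c hr).trans h1
    _ = _ := by ring

/-- The John–Nirenberg inequality in mean square. -/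
theorem ballAvg_sq_le {n : ℕ} (hn : 1 ≤ n) {f : Eucl n → ℂ}
    (hf : LocallyIntegrable f) (hb : bmoNorm f ≠ ∞) (c : Eucl n) {r : ℝ} (hr : 0 < r) :
    ballAvg (fun x => ‖f x - ⨍ y in ball c r, f y‖ₑ ^ 2) c r ≤ 12 * stopHeight f ^ 2 := by
  have hk : ∀ k : ℕ, ballAvg (fun x => ‖clampC k (f x) -
      ⨍ y in ball c r, clampC k (f y)‖ₑ ^ 2) c r ≤ 12 * stopHeight f ^ 2 := by
    intro k
    have h1 := bmoNorm_clampC_le hf k.cast_nonneg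
    refine (ballAvg_sq_le_of_bounded hn (locallyIntegrable_clampC hf k.cast_nonneg)
      (ne_top_of_le_ne_top (by finiteness) h1)
      (fun x => norm_clampC_le_bound k k.cast_nonneg (f x)) c hr).trans ?_
    calc _ ≤ 3 * (2 * 4 ^ n * (8 * 5 ^ n) * (2 * bmoNorm f)) ^ 2 := by
          unfold stopHeight; gcongr
      _ = _ := by unfold stopHeight; ring
  have hlim : ∀ x, Filter.Tendsto (fun k : ℕ => clampC k (f x)) Filter.atTop (nhds (f x)) := by
    intro x
    refine tendsto_const_nhds.congr' ?_
    filter_upwards [Filter.eventually_ge_atTop ⌈‖f x‖⌉₊] with k hk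
    exact (clampC_eq_self ((Nat.le_ceil _).trans (by exact_mod_cast hk))).symm
  have hlimavg : Filter.Tendsto (fun k : ℕ => ⨍ y in ball c r, clampC k (f y)) Filter.atTop
      (nhds (⨍ y in ball c r, f y)) := by
    simp only [setAverage_eq]
    refine Filter.Tendsto.const_smul (tendsto_integral_of_dominated_convergence
      (fun y => ‖f y‖) (fun k => ?_) (integrableOn_ball hf c r).norm
      (fun k => Filter.Eventually.of_forall fun y => norm_clampC_le k k.cast_nonneg _)
      (Filter.Eventually.of_forall hlim)) _
    exact ((continuous_clampC k).comp_aestronglyMeasurable hf.aestronglyMeasurable).restrict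
  have hmeas : ∀ k : ℕ, AEMeasurable (fun x => ‖clampC k (f x) -
      ⨍ y in ball c r, clampC k (f y)‖ₑ ^ 2) (volume.restrict (ball c r)) := fun k =>
    (((continuous_clampC k).comp_aestronglyMeasurable hf.aestronglyMeasurable).sub
      aestronglyMeasurable_const).enorm.restrict.pow_const 2
  have hfatou : ∫⁻ x in ball c r, ‖f x - ⨍ y in ball c r, f y‖ₑ ^ 2 ≤
      volume (ball c r) * (12 * stopHeight f ^ 2) := by
    calc _ = ∫⁻ x in ball c r, Filter.liminf (fun k : ℕ => ‖clampC k (f x) -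
          ⨍ y in ball c r, clampC k (f y)‖ₑ ^ 2) Filter.atTop := by
          refine lintegral_congr fun x => ?_
          exact (((ENNReal.continuous_pow 2).tendsto _).comp
            ((hlim x).sub hlimavg).enorm).liminf_eq.symm
      _ ≤ Filter.liminf (fun k : ℕ => ∫⁻ x in ball c r, ‖clampC k (f x) -
          ⨍ y in ball c r, clampC k (f y)‖ₑ ^ 2) Filter.atTop := lintegral_liminf_le' hmeas
      _ ≤ _ := by
          refine Filter.liminf_le_of_le (by isBoundedDefault) fun b hb => ?_
          obtain ⟨k, hk'⟩ := hb.exists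
          refine hk'.trans ?_
          rw [lintegral_ball_eq _ _ hr]
          gcongr
          exact hk k
  rw [lintegral_ball_eq _ _ hr] at hfatou
  exact (ENNReal.mul_le_mul_iff_right (volume_ball_ne_zero c hr) (volume_ball_ne_top c r)).1 hfatou

/-! ### Kernel estimates -/

/-- `φ` is continuous and, together with its increments of length at most `2`, is dominated by
`A (1 + |y|)^{-(n+1)}`. -/
structure PoissonBounded {n : ℕ} (φ : Eucl n → ℝ) (A : ℝ) : Prop where
  pos : 0 < A
  continuous : Continuous φ
  abs_le : ∀ y, |φ y| ≤ A / (1 + ‖y‖) ^ (n + 1)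
  abs_sub_le : ∀ y y', ‖y - y'‖ ≤ 2 → |φ y - φ y'| ≤ A * ‖y - y'‖ / (1 + ‖y‖) ^ (n + 1)

theorem exists_poissonBounded {n : ℕ} (φ : 𝓢(Eucl n, ℝ)) :
    ∃ A, PoissonBounded (φ : Eucl n → ℝ) A := by
  obtain ⟨S, hS0, hS⟩ : ∃ S : ℝ, 0 < S ∧ ∀ k ≤ 1, ∀ y,
      ‖iteratedFDeriv ℝ k φ y‖ ≤ S / (1 + ‖y‖) ^ (n + 1) := by
    set S₀ : ℝ := 2 ^ (n + 1) * ((Finset.Iic (n + 1, 1)).sup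
      fun m => SchwartzMap.seminorm ℝ m.1 m.2) φ
    refine ⟨max S₀ 1, by positivity, fun k hk y => ?_⟩
    rw [le_div_iff₀ (by positivity), mul_comm]
    exact (SchwartzMap.one_add_le_sup_seminorm_apply (𝕜 := ℝ) (m := (n + 1, 1)) (k := n + 1)
      le_rfl hk φ y).trans (le_max_left _ _)
  have h3 : (1 : ℝ) ≤ 3 ^ (n + 1) := one_le_pow₀ (by norm_num)
  refine ⟨3 ^ (n + 1) * S, by positivity, φ.continuous, fun y => ?_, fun y y' hy => ?_⟩
  · have := hS 0 zero_le_one y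
    rw [norm_iteratedFDeriv_zero, Real.norm_eq_abs] at this
    refine this.trans ?_
    gcongr
    nlinarith
  · have hder : ∀ z ∈ closedBall y 2, ‖fderiv ℝ φ z‖ ≤ 3 ^ (n + 1) * S / (1 + ‖y‖) ^ (n + 1) := by
      intro z hz
      have h1 := hS 1 le_rfl z
      rw [norm_iteratedFDeriv_one] at h1
      refine h1.trans ?_
      have h2 : ‖y‖ ≤ ‖z‖ + 2 := by
        have := norm_sub_norm_le y z
        rw [mem_closedBall, dist_comm, dist_eq_norm] at hz
        linarith
      rw [div_le_div_iff₀ (by positivity) (by positivity)]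
      calc S * (1 + ‖y‖) ^ (n + 1) ≤ S * (3 * (1 + ‖z‖)) ^ (n + 1) := by
            gcongr; linarith [norm_nonneg z]
        _ = _ := by rw [mul_pow]; ring
    have := (convex_closedBall y 2).norm_image_sub_le_of_norm_fderiv_le (𝕜 := ℝ)
      (fun z _ => φ.differentiable z) hder
      (show y' ∈ closedBall y 2 by rwa [mem_closedBall, dist_comm, dist_eq_norm])
      (mem_closedBall_self zero_le_two)
    rw [Real.norm_eq_abs] at this
    exact this.trans (le_of_eq (by ring))

theorem continuous_dilation {n : ℕ} {φ : Eucl n → ℝ} (hφ : Continuous φ) (t : ℝ) :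
    Continuous (dilation φ t) := by unfold dilation; fun_prop

theorem weight_dilation {n : ℕ} {t : ℝ} (ht : 0 < t) (y : Eucl n) (B : ℝ) :
    (t ^ n)⁻¹ * (B / (1 + ‖t⁻¹ • y‖) ^ (n + 1)) = B * poissonWeight n t ‖y‖ := by
  have h1 : 1 + ‖t⁻¹ • y‖ = (t + ‖y‖) / t := by
    rw [norm_smul, Real.norm_of_nonneg (by positivity)]; field_simp
  rw [h1, poissonWeight, div_pow]
  have : 0 < t + ‖y‖ := by positivity
  field_simp
  ring

theorem PoissonBounded.abs_dilation_le {n : ℕ} {φ : Eucl n → ℝ} {A : ℝ}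
    (hφ : PoissonBounded φ A) {t : ℝ} (ht : 0 < t) (y : Eucl n) :
    |dilation φ t y| ≤ A * poissonWeight n t ‖y‖ := by
  rw [dilation, abs_mul, abs_of_pos (by positivity), ← weight_dilation ht]
  gcongr
  exact hφ.abs_le _

theorem PoissonBounded.abs_dilation_sub_le {n : ℕ} {φ : Eucl n → ℝ} {A : ℝ}
    (hφ : PoissonBounded φ A) {t : ℝ} (ht : 0 < t) {y y' : Eucl n} (hy : ‖y - y'‖ ≤ 2 * t) :
    |dilation φ t y - dilation φ t y'| ≤ A * (‖y - y'‖ / t) * poissonWeight n t ‖y‖ := by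
  have h1 : ‖t⁻¹ • y - t⁻¹ • y'‖ = ‖y - y'‖ / t := by
    rw [← smul_sub, norm_smul, Real.norm_of_nonneg (by positivity)]; ring
  rw [dilation, dilation, ← mul_sub, abs_mul, abs_of_pos (by positivity), ← weight_dilation ht]
  gcongr
  rw [← h1]
  exact hφ.abs_sub_le _ _ (by rw [h1, div_le_iff₀ ht]; exact hy)

theorem convOp_apply {n : ℕ} (φ : Eucl n → ℝ) (t : ℝ) (f : Eucl n → ℂ) (x : Eucl n) :
    convOp φ t f x = ∫ z, dilation φ t (x - z) • f z := by
  rw [convOp, convolution_eq_swap]; rfl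

/-- Integration of `g` against a kernel dominated by a multiple of the weight at scale `t`. -/
theorem enorm_integral_smul_le {n : ℕ} {κ : Eucl n → ℝ} {g : Eucl n → ℂ} {x : Eucl n} {t B : ℝ}
    (hB : 0 ≤ B) (hκ : ∀ z, |κ z| ≤ B * poissonWeight n t ‖x - z‖) :
    ∫⁻ z, ‖κ z • g z‖ₑ ≤
      ENNReal.ofReal B * ∫⁻ z, ENNReal.ofReal (poissonWeight n t ‖x - z‖) * ‖g z‖ₑ := by
  rw [← lintegral_const_mul' _ _ ENNReal.ofReal_ne_top]
  refine lintegral_mono fun z => ?_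
  simp only [enorm_smul, ← mul_assoc, ← ENNReal.ofReal_mul hB]
  gcongr
  rw [← ofReal_norm, Real.norm_eq_abs]
  exact ENNReal.ofReal_le_ofReal (hκ z)

theorem PoissonBounded.integrable_smul {n : ℕ} {φ : Eucl n → ℝ} {A : ℝ}
    (hφ : PoissonBounded φ A) {t : ℝ} (ht : 0 < t) {x : Eucl n} {g : Eucl n → ℂ}
    (hg : AEStronglyMeasurable g)
    (hfin : ∫⁻ z, ENNReal.ofReal (poissonWeight n t ‖x - z‖) * ‖g z‖ₑ ≠ ∞) :
    Integrable fun z => dilation φ t (x - z) • g z := by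
  refine ⟨((continuous_dilation hφ.continuous t).comp
    (continuous_const.sub continuous_id)).aestronglyMeasurable.smul hg, ?_⟩
  exact (enorm_integral_smul_le hφ.pos.le fun z => hφ.abs_dilation_le ht _).trans_lt
    (ENNReal.mul_lt_top ENNReal.ofReal_lt_top hfin.lt_top)

theorem PoissonBounded.integrable_dilation {n : ℕ} {φ : Eucl n → ℝ} {A : ℝ}
    (hφ : PoissonBounded φ A) {t : ℝ} (ht : 0 < t) (x : Eucl n) (a : ℂ) :
    Integrable fun z => dilation φ t (x - z) • a := by
  refine hφ.integrable_smul ht aestronglyMeasurable_const ?_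
  rw [lintegral_mul_const _ (measurable_poissonWeight t x)]
  exact ENNReal.mul_ne_top (ne_top_of_le_ne_top (ENNReal.mul_ne_top (weightConst_ne_top n)
    ENNReal.ofNat_ne_top) (lintegral_poissonWeight_le ht x)) enorm_ne_top

theorem integral_dilation_smul {n : ℕ} {φ : Eucl n → ℝ} (h1 : ∫ x, φ x = 1) {t : ℝ} (ht : 0 < t)
    (x : Eucl n) (a : ℂ) : ∫ z, dilation φ t (x - z) • a = a := by
  have h2 : ∫ z, dilation φ t (x - z) = 1 := by
    rw [integral_sub_left_eq_self (dilation φ t) volume x]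
    simp only [dilation]
    rw [integral_const_mul, Measure.integral_comp_inv_smul_of_nonneg _ _ ht.le, h1]
    simp [ht.ne']
  rw [integral_smul_const, h2, one_smul]

/-- The constant in the bounds for the convolution operators on functions of bounded mean
oscillation. -/
noncomputable def bmoConst (n : ℕ) : ℝ≥0∞ := weightConst n * (8 * 2 ^ n)

theorem bmoConst_ne_top (n : ℕ) : bmoConst n ≠ ∞ :=
  ENNReal.mul_ne_top (weightConst_ne_top n) (by finiteness)

theorem lintegral_poissonWeight_sub_le {n : ℕ} {f : Eucl n → ℂ} (hf : LocallyIntegrable f)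
    {t : ℝ} (ht : 0 < t) (x : Eucl n) :
    ∫⁻ z, ENNReal.ofReal (poissonWeight n t ‖x - z‖) * ‖f z - ⨍ y in ball x t, f y‖ₑ ≤
      bmoConst n * bmoNorm f := by
  refine (lintegral_poissonWeight_bmo_le hf ht x).trans ?_
  rw [ofReal_ofNat_pow, bmoConst]
  gcongr
  norm_num

/-- Off-centre version of `lintegral_poissonWeight_sub_le`. -/
theorem lintegral_poissonWeight_sub_le_of_mem {n : ℕ} {f : Eucl n → ℂ} (hf : LocallyIntegrable f)
    {r : ℝ} (hr : 0 < r) {c x : Eucl n} (hx : x ∈ ball c r) :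
    ∫⁻ z, ENNReal.ofReal (poissonWeight n r ‖x - z‖) * ‖f z - ⨍ y in ball c r, f y‖ₑ ≤
      bmoConst n * bmoNorm f := by
  have h2 : ‖(⨍ y in ball x r, f y) - ⨍ y in ball c r, f y‖ₑ ≤ 2 * 2 ^ n * bmoNorm f := by
    have h3 := enorm_average_sub_average_le hf (c := x) (c' := x) hr (by positivity) two_pos
      (ball_subset_ball (by linarith)) le_rfl
    have h4 := enorm_average_sub_average_le hf (c := c) (c' := x) hr (by positivity) two_pos
      (ball_subset_ball' (by rw [mem_ball, dist_comm] at hx; linarith)) le_rfl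
    rw [ofReal_ofNat_pow, ← edist_eq_enorm_sub] at h3 h4
    rw [← edist_eq_enorm_sub]
    calc _ ≤ _ := edist_triangle_right _ _ (⨍ y in ball x (2 * r), f y)
      _ ≤ 2 ^ n * bmoNorm f + 2 ^ n * bmoNorm f := add_le_add h3 h4
      _ = _ := by ring
  have hm := measurable_poissonWeight r x
  calc _ ≤ ∫⁻ z, (ENNReal.ofReal (poissonWeight n r ‖x - z‖) * ‖f z - ⨍ y in ball x r, f y‖ₑ +
        ENNReal.ofReal (poissonWeight n r ‖x - z‖) * (2 * 2 ^ n * bmoNorm f)) := by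
        refine lintegral_mono fun z => ?_
        rw [← mul_add]
        gcongr
        calc _ = ‖(f z - ⨍ y in ball x r, f y) +
              ((⨍ y in ball x r, f y) - ⨍ y in ball c r, f y)‖ₑ := by congr 1; ring
          _ ≤ _ := (enorm_add_le _ _).trans (by gcongr)
    _ ≤ weightConst n * (4 * 2 ^ n) * bmoNorm f + weightConst n * 2 * (2 * 2 ^ n * bmoNorm f) := by
        rw [lintegral_add_right _ (hm.mul_const _), lintegral_mul_const _ hm, ← ofReal_ofNat_pow]
        gcongr
        · exact lintegral_poissonWeight_bmo_le hf hr x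
        · exact lintegral_poissonWeight_le hr x
    _ = _ := by rw [bmoConst]; ring

section

variable {n : ℕ} {φ : Eucl n → ℝ} {A : ℝ} {f : Eucl n → ℂ}

theorem integrable_dilation_smul_bmo (hφ : PoissonBounded φ A) (hf : MemBMO f) {t : ℝ}
    (ht : 0 < t) (x : Eucl n) : Integrable fun z => dilation φ t (x - z) • f z := by
  have h1 := hφ.integrable_smul ht (hf.1.aestronglyMeasurable.sub aestronglyMeasurable_const)
    (ne_top_of_le_ne_top (ENNReal.mul_ne_top (bmoConst_ne_top n) hf.2.ne)
      (lintegral_poissonWeight_sub_le hf.1 ht x))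
  refine (h1.add (hφ.integrable_dilation ht x (⨍ y in ball x t, f y))).congr
    (Filter.Eventually.of_forall fun z => ?_)
  simp [smul_sub]

theorem convOp_sub_const (hφ : PoissonBounded φ A) (h1 : ∫ x, φ x = 1) (hf : MemBMO f) {t : ℝ}
    (ht : 0 < t) (x : Eucl n) (a : ℂ) :
    convOp φ t f x - a = ∫ z, dilation φ t (x - z) • (f z - a) := by
  simp only [smul_sub]
  rw [integral_sub (integrable_dilation_smul_bmo hφ hf ht x) (hφ.integrable_dilation ht x a),
    integral_dilation_smul h1 ht, convOp_apply]

theorem enorm_convOp_sub_average_le (hφ : PoissonBounded φ A) (h1 : ∫ x, φ x = 1) (hf : MemBMO f)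
    {t : ℝ} (ht : 0 < t) (x : Eucl n) :
    ‖convOp φ t f x - ⨍ y in ball x t, f y‖ₑ ≤ ENNReal.ofReal A * (bmoConst n * bmoNorm f) := by
  rw [convOp_sub_const hφ h1 hf ht]
  refine (enorm_integral_le_lintegral_enorm _).trans
    ((enorm_integral_smul_le hφ.pos.le fun z => hφ.abs_dilation_le ht _).trans ?_)
  gcongr
  exact lintegral_poissonWeight_sub_le hf.1 ht x

/-- At scales at least comparable to `|x - y|` the function `Φ_t f` has oscillation
`O(|x - y| / t)`. -/
theorem enorm_convOp_sub_convOp_le (hφ : PoissonBounded φ A) (h1 : ∫ x, φ x = 1) (hf : MemBMO f)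
    {t : ℝ} (ht : 0 < t) {x y : Eucl n} (hxy : ‖x - y‖ ≤ 2 * t) :
    ‖convOp φ t f x - convOp φ t f y‖ₑ ≤
      ENNReal.ofReal (A * (‖x - y‖ / t)) * (bmoConst n * bmoNorm f) := by
  have hi := fun w => (integrable_dilation_smul_bmo hφ hf ht w).sub
    (hφ.integrable_dilation ht w (⨍ y in ball x t, f y))
  have h2 : convOp φ t f x - convOp φ t f y
      = ∫ z, (dilation φ t (x - z) - dilation φ t (y - z)) • (f z - ⨍ y in ball x t, f y) := by
    rw [← sub_sub_sub_cancel_right _ _ (⨍ y in ball x t, f y), convOp_sub_const hφ h1 hf ht,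
      convOp_sub_const hφ h1 hf ht, ← integral_sub]
    · simp only [sub_smul]
    · exact (hi x).congr (Filter.Eventually.of_forall fun z => by simp [smul_sub])
    · exact (hi y).congr (Filter.Eventually.of_forall fun z => by simp [smul_sub])
  rw [h2]
  refine (enorm_integral_le_lintegral_enorm _).trans
    ((enorm_integral_smul_le (x := x) (t := t) (B := A * (‖x - y‖ / t))
      (mul_nonneg hφ.pos.le (by positivity)) fun z => ?_).trans ?_)
  · have := hφ.abs_dilation_sub_le ht (y := x - z) (y' := y - z) (by simpa using hxy)
    simpa using this
  · gcongr
    exact lintegral_poissonWeight_sub_le hf.1 ht x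

theorem continuous_convOp (hφ : PoissonBounded φ A) (h1 : ∫ x, φ x = 1) (hf : MemBMO f)
    {t : ℝ} (ht : 0 < t) : Continuous (convOp φ t f) := by
  refine continuous_iff_continuousAt.2 fun x => ?_
  rw [ContinuousAt, tendsto_iff_edist_tendsto_0]
  have hlim : Filter.Tendsto (fun y => ENNReal.ofReal (A * (‖y - x‖ / t)) *
      (bmoConst n * bmoNorm f)) (nhds x) (nhds 0) := by
    have : Continuous fun y : Eucl n => ENNReal.ofReal (A * (‖y - x‖ / t)) :=
      ENNReal.continuous_ofReal.comp (by fun_prop)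
    have h2 := ENNReal.Tendsto.mul_const (this.tendsto x)
      (Or.inr (ENNReal.mul_ne_top (bmoConst_ne_top n) hf.2.ne))
    simpa using h2
  refine tendsto_of_tendsto_of_tendsto_of_le_of_le' tendsto_const_nhds hlim
    (Filter.Eventually.of_forall fun _ => zero_le) ?_
  filter_upwards [ball_mem_nhds x (show 0 < 2 * t by positivity)] with y hy
  rw [edist_eq_enorm_sub]
  exact enorm_convOp_sub_convOp_le hφ h1 hf ht (by rw [← dist_eq_norm]; exact (mem_ball.1 hy).le)

/-- The recentred local part `(f - f_B) 1_{2B}` of `f` on the ball `B = B(c, r)`. -/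
noncomputable def localPart (f : Eucl n → ℂ) (c : Eucl n) (r : ℝ) : Eucl n → ℂ :=
  (ball c (2 * r)).indicator fun z => f z - ⨍ y in ball c r, f y

theorem aestronglyMeasurable_localPart (hf : LocallyIntegrable f) (c : Eucl n) (r : ℝ) :
    AEStronglyMeasurable (localPart f c r) :=
  (hf.aestronglyMeasurable.sub aestronglyMeasurable_const).indicator measurableSet_ball

theorem lintegral_localPart_sq_le (hn : 1 ≤ n) (hf : MemBMO f) (c : Eucl n) {r : ℝ} (hr : 0 < r) :
    ∫⁻ z, ‖localPart f c r z‖ₑ ^ 2 ≤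
      volume (ball c r) * (52 * 2 ^ n * stopHeight f ^ 2) := by
  have hr2 : 0 < 2 * r := by positivity
  set a := ⨍ y in ball c r, f y with ha
  set a' := ⨍ y in ball c (2 * r), f y with ha'
  have haa : ‖a' - a‖ₑ ≤ stopHeight f := by
    have := enorm_average_sub_average_le hf.1 (c := c) (c' := c) hr hr2 two_pos
      (ball_subset_ball (by linarith)) le_rfl
    rw [ofReal_ofNat_pow, enorm_sub_rev] at this
    refine this.trans ?_
    rw [stopHeight]
    gcongr
    calc (2 : ℝ≥0∞) ^ n ≤ 4 ^ n := by gcongr; norm_num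
      _ = 1 * 4 ^ n * (1 * 1 ^ n) := by ring
      _ ≤ _ := by gcongr <;> norm_num
  have h1 : ∫⁻ z, ‖localPart f c r z‖ₑ ^ 2
      = ∫⁻ z in ball c (2 * r), ‖f z - a‖ₑ ^ 2 := by
    rw [← lintegral_indicator measurableSet_ball]
    refine lintegral_congr fun z => ?_
    by_cases hz : z ∈ ball c (2 * r) <;> simp [localPart, hz, ha]
  rw [h1, lintegral_ball_eq _ _ hr2, volume_ball_mul c c two_pos hr, ofReal_ofNat_pow]
  have h2 : ballAvg (fun z => ‖f z - a‖ₑ ^ 2) c (2 * r) ≤ 52 * stopHeight f ^ 2 := by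
    calc _ ≤ ballAvg (fun z => 4 * ‖f z - a'‖ₑ ^ 2 + 4 * stopHeight f ^ 2) c (2 * r) := by
          refine ballAvg_mono (fun z => ?_) _ _
          calc ‖f z - a‖ₑ ^ 2 = ‖(f z - a') + (a' - a)‖ₑ ^ 2 := by congr 2; ring
            _ ≤ (‖f z - a'‖ₑ + stopHeight f) ^ 2 := by
              gcongr; exact (enorm_add_le _ _).trans (by gcongr)
            _ ≤ _ := (ENNReal.add_sq_le_four_mul _ _).trans (by rw [mul_add])
      _ = 4 * ballAvg (fun z => ‖f z - a'‖ₑ ^ 2) c (2 * r) + 4 * stopHeight f ^ 2 := by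
          rw [ballAvg_add_const _ _ _ hr2, ballAvg, lintegral_const_mul' _ _ (by finiteness),
            ballAvg]
          ring
      _ ≤ 4 * (12 * stopHeight f ^ 2) + 4 * stopHeight f ^ 2 := by
          gcongr; exact ballAvg_sq_le hn hf.1 hf.2.ne c hr2
      _ = _ := by ring
  calc _ ≤ 2 ^ n * volume (ball c r) * (52 * stopHeight f ^ 2) := by gcongr
    _ = _ := by ring

/-- On the ball `B` the operator `Φ_t` differs from its action on the local part, up to the
constant `f_B`, by `O(t / r)`. -/
theorem enorm_convOp_sub_localPart_le (hφ : PoissonBounded φ A) (h1 : ∫ x, φ x = 1)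
    (hf : MemBMO f) {t r : ℝ} (ht : 0 < t) (hr : 0 < r) {c x : Eucl n} (hx : x ∈ ball c r) :
    ‖convOp φ t f x - (⨍ y in ball c r, f y) - convOp φ t (localPart f c r) x‖ₑ ≤
      ENNReal.ofReal (A * (2 ^ (n + 1) * (t / r))) * (bmoConst n * bmoNorm f) := by
  set a := ⨍ y in ball c r, f y with ha
  have hi : Integrable fun z => dilation φ t (x - z) • (f z - a) :=
    ((integrable_dilation_smul_bmo hφ hf ht x).sub (hφ.integrable_dilation ht x a)).congr
      (Filter.Eventually.of_forall fun z => by simp [smul_sub])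
  have hsplit : ∀ z, dilation φ t (x - z) • localPart f c r z
      = (ball c (2 * r)).indicator (fun z => dilation φ t (x - z) • (f z - a)) z := fun z => by
    by_cases hz : z ∈ ball c (2 * r) <;> simp [localPart, hz, ha]
  rw [convOp_sub_const hφ h1 hf ht, convOp_apply]
  simp only [hsplit]
  rw [← integral_sub hi (hi.indicator measurableSet_ball)]
  set κ : Eucl n → ℝ := (ball c (2 * r))ᶜ.indicator fun z => dilation φ t (x - z) with hκ
  have h2 : ∀ z, dilation φ t (x - z) • (f z - a) -
      (ball c (2 * r)).indicator (fun z => dilation φ t (x - z) • (f z - a)) z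
      = κ z • (f z - a) := fun z => by
    by_cases hz : z ∈ ball c (2 * r) <;> simp [hκ, hz]
  simp only [h2]
  refine (enorm_integral_le_lintegral_enorm _).trans
    ((enorm_integral_smul_le (x := x) (t := r) (B := A * (2 ^ (n + 1) * (t / r)))
      (mul_nonneg hφ.pos.le (by positivity)) fun z => ?_).trans ?_)
  · by_cases hz : z ∈ ball c (2 * r)
    · have := poissonWeight_nonneg n hr (norm_nonneg (x - z))
      have := hφ.pos
      simp only [hκ, Set.indicator_of_notMem (Set.notMem_compl_iff.2 hz), abs_zero]
      positivity
    · simp only [hκ, Set.indicator_of_mem (Set.mem_compl hz)]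
      have hxz : r ≤ ‖x - z‖ := by
        rw [mem_ball, not_lt] at hz
        rw [mem_ball] at hx
        have := dist_triangle_left z c x
        rw [← dist_eq_norm]
        linarith
      refine (hφ.abs_dilation_le ht _).trans ?_
      rw [mul_assoc A]
      refine mul_le_mul_of_nonneg_left ?_ hφ.pos.le
      unfold poissonWeight
      calc t / (t + ‖x - z‖) ^ (n + 1) ≤ t / ((r + ‖x - z‖) / 2) ^ (n + 1) := by
            gcongr; linarith
        _ = _ := by
            have : 0 < r + ‖x - z‖ := by positivity
            rw [div_pow]; field_simp
  · gcongr
    exact lintegral_poissonWeight_sub_le_of_mem hf.1 hr hx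

end

/-! ### Lacunary sums -/

/-- Sums of a lacunary sequence are dominated by the last term. -/
theorem sum_le_of_ratio {δ : ℝ} (hδ : 1 < δ) {a : ℤ → ℝ} (ha : ∀ i, 0 < a i)
    (hr : ∀ i, δ * a i ≤ a (i + 1)) (F : Finset ℤ) :
    ∀ M : ℤ, (∀ i ∈ F, i ≤ M) → ∑ i ∈ F, a i ≤ δ / (δ - 1) * a M := by
  have hmono : Monotone a := monotone_int_of_le_succ fun i =>
    (le_mul_of_one_le_left (ha i).le hδ.le).trans (hr i)
  have hδ1 : 0 < δ - 1 := by linarith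
  induction F using Finset.induction_on_max with
  | empty =>
    intro M _
    have := ha M
    rw [Finset.sum_empty]
    positivity
  | insert m s hs ih =>
    intro M hM
    rw [Finset.sum_insert fun h => lt_irrefl _ (hs m h)]
    have h1 := ih (m - 1) fun i hi => by have := hs i hi; omega
    have h2 := hr (m - 1)
    rw [sub_add_cancel] at h2
    have h3 := hmono (hM m (Finset.mem_insert_self m s))
    calc a m + ∑ i ∈ s, a i ≤ a m + 1 / (δ - 1) * a m := by
          refine add_le_add le_rfl (h1.trans ?_)
          calc δ / (δ - 1) * a (m - 1) = 1 / (δ - 1) * (δ * a (m - 1)) := by ring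
            _ ≤ _ := by gcongr
      _ = δ / (δ - 1) * a m := by field_simp; ring
      _ ≤ _ := by gcongr

theorem sum_filter_le_of_ratio {δ : ℝ} (hδ : 1 < δ) {a : ℤ → ℝ} (ha : ∀ i, 0 < a i)
    (hr : ∀ i, δ * a i ≤ a (i + 1)) (F : Finset ℤ) {R : ℝ} (hR : 0 ≤ R) (hF : ∀ i ∈ F, a i ≤ R) :
    ∑ i ∈ F, a i ≤ δ / (δ - 1) * R := by
  have hδ1 : 0 < δ - 1 := by linarith
  rcases F.eq_empty_or_nonempty with rfl | hne
  · rw [Finset.sum_empty]; positivity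
  · refine (sum_le_of_ratio hδ ha hr F (F.max' hne) fun i hi => F.le_max' i hi).trans ?_
    gcongr
    exact hF _ (F.max'_mem hne)

section

variable {δ : ℝ} {a : ℤ → ℝ}

theorem IsLacunary.ratio (h : IsLacunary δ a) (i : ℤ) : δ * a i ≤ a (i + 1) :=
  (le_div_iff₀ (h.2.1 i)).1 (h.2.2 i)

theorem IsLacunary.monotone (h : IsLacunary δ a) : Monotone a :=
  monotone_int_of_le_succ fun i =>
    (le_mul_of_one_le_left (h.2.1 i).le h.1.le).trans (h.ratio i)

/-- The lacunary summation constant `δ / (δ - 1)`. -/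
noncomputable def lacConst (δ : ℝ) : ℝ := δ / (δ - 1)

theorem IsLacunary.lacConst_pos (h : IsLacunary δ a) : 0 < lacConst δ :=
  div_pos (by linarith [h.1]) (by linarith [h.1])

theorem IsLacunary.sum_le (h : IsLacunary δ a) (F : Finset ℤ) {R : ℝ} (hR : 0 ≤ R)
    (hF : ∀ i ∈ F, a i ≤ R) : ∑ i ∈ F, a i ≤ lacConst δ * R :=
  sum_filter_le_of_ratio h.1 h.2.1 h.ratio F hR hF

theorem IsLacunary.sum_inv_le (h : IsLacunary δ a) (F : Finset ℤ) {R : ℝ} (hR : 0 < R)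
    (hF : ∀ i ∈ F, R ≤ a i) : ∑ i ∈ F, (a i)⁻¹ ≤ lacConst δ * R⁻¹ := by
  -- the reversed sequence of reciprocals is lacunary as well
  have h1 := sum_filter_le_of_ratio h.1 (a := fun i => (a (-i))⁻¹)
    (fun i => inv_pos.2 (h.2.1 _)) (fun i => ?_) (F.map (Equiv.neg ℤ).toEmbedding)
    (inv_nonneg.2 hR.le) fun i hi => ?_
  · rw [Finset.sum_map] at h1
    rw [lacConst]
    simpa using h1
  · have h2 := h.ratio (-(i + 1))
    rw [show -(i + 1) + 1 = -i by ring] at h2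
    have h3 := h.2.1 (-(i + 1))
    have h4 := h.2.1 (-i)
    rw [← div_eq_mul_inv, div_le_iff₀ h4, inv_mul_eq_div, le_div_iff₀ h3]
    exact h2
  · simp only [Finset.mem_map, Equiv.coe_toEmbedding, Equiv.neg_apply] at hi
    obtain ⟨j, hj, rfl⟩ := hi
    rw [neg_neg]
    exact inv_anti₀ hR (hF j hj)

/-- The quantity `min(a_i s, (a_i s)⁻¹)` which governs the multipliers at frequencies of norm
`s`. -/
noncomputable def bump (a : ℤ → ℝ) (s : ℝ) (i : ℤ) : ℝ := min (a i * s) (a i * s)⁻¹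

theorem IsLacunary.bump_nonneg (h : IsLacunary δ a) {s : ℝ} (hs : 0 < s) (i : ℤ) :
    0 ≤ bump a s i := by
  have := h.2.1 i
  unfold bump; positivity

theorem IsLacunary.bump_le_one (h : IsLacunary δ a) (s : ℝ) (i : ℤ) :
    bump a s i ≤ 1 := by
  have := h.2.1 i
  rcases le_total (a i * s) 1 with h1 | h1
  · exact (min_le_left _ _).trans h1
  · exact (min_le_right _ _).trans (inv_le_one_of_one_le₀ h1)

theorem IsLacunary.sum_bump_le (h : IsLacunary δ a) {s : ℝ} (hs : 0 < s) (F : Finset ℤ) :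
    ∑ i ∈ F, bump a s i ≤ 2 * lacConst δ := by
  rw [← Finset.sum_filter_add_sum_filter_not F fun i => a i ≤ s⁻¹]
  have h1 : ∑ i ∈ F with a i ≤ s⁻¹, bump a s i ≤ lacConst δ := by
    calc _ ≤ ∑ i ∈ F with a i ≤ s⁻¹, a i * s := Finset.sum_le_sum fun i _ => min_le_left _ _
      _ = (∑ i ∈ F with a i ≤ s⁻¹, a i) * s := by rw [Finset.sum_mul]
      _ ≤ lacConst δ * s⁻¹ * s := by
        gcongr
        exact h.sum_le _ (by positivity) fun i hi => (Finset.mem_filter.1 hi).2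
      _ = _ := by field_simp
  have h2 : ∑ i ∈ F with ¬ a i ≤ s⁻¹, bump a s i ≤ lacConst δ := by
    calc _ ≤ ∑ i ∈ F with ¬ a i ≤ s⁻¹, (a i)⁻¹ * s⁻¹ := Finset.sum_le_sum fun i _ =>
          (min_le_right _ _).trans (mul_inv _ _).le
      _ = (∑ i ∈ F with ¬ a i ≤ s⁻¹, (a i)⁻¹) * s⁻¹ := by rw [Finset.sum_mul]
      _ ≤ lacConst δ * (s⁻¹)⁻¹ * s⁻¹ := by
        gcongr
        exact h.sum_inv_le _ (by positivity) fun i hi => (not_le.1 (Finset.mem_filter.1 hi).2).le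
      _ = _ := by field_simp
  linarith

/-! ### Multiplier estimates -/

/-- The multiplier of `v_i (Φ_{a_{i+1}} - Φ_{a_i})`, where `p` is the Fourier transform
of `φ`. -/
noncomputable def diffMult {n : ℕ} (p : Eucl n → ℂ) (a : ℤ → ℝ) (v : ℤ → ℂ) (ξ : Eucl n)
    (i : ℤ) : ℂ := v i * (p (a (i + 1) • ξ) - p (a i • ξ))

/-- The regularity of the Fourier transform of `φ` that enters the multiplier estimates. -/
structure MultBounded {n : ℕ} (p : Eucl n → ℂ) (L : ℝ) : Prop where
  norm_le : ∀ ξ, ‖p ξ‖ ≤ L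
  decay : ∀ ξ, ‖ξ‖ * ‖p ξ‖ ≤ L
  norm_sub_one_le : ∀ ξ, ‖p ξ - 1‖ ≤ L * ‖ξ‖

variable {n : ℕ} {p : Eucl n → ℂ} {L V : ℝ} {v : ℤ → ℂ}

theorem MultBounded.nonneg (hp : MultBounded p L) : 0 ≤ L := (norm_nonneg _).trans (hp.norm_le 0)

theorem MultBounded.norm_le_inv (hp : MultBounded p L) {t : ℝ} (ht : 0 < t) {ξ : Eucl n}
    (hξ : 0 < ‖ξ‖) : ‖p (t • ξ)‖ ≤ L * (t * ‖ξ‖)⁻¹ := by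
  have := hp.decay (t • ξ)
  rw [norm_smul, Real.norm_of_nonneg ht.le, mul_comm] at this
  rw [← div_eq_mul_inv]
  exact (le_div_iff₀ (by positivity)).2 this

theorem MultBounded.norm_smul_sub_one_le (hp : MultBounded p L) {t : ℝ} (ht : 0 < t) (ξ : Eucl n) :
    ‖p (t • ξ) - 1‖ ≤ L * (t * ‖ξ‖) := by
  have := hp.norm_sub_one_le (t • ξ)
  rwa [norm_smul, Real.norm_of_nonneg ht.le] at this

theorem MultBounded.norm_diffMult_le (hp : MultBounded p L) (ha : IsLacunary δ a)
    (ha2 : ∀ i, a (i + 1) / a i ≤ δ ^ 2) (hv : ∀ i, ‖v i‖ ≤ V) {ξ : Eucl n} (hξ : 0 < ‖ξ‖)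
    (i : ℤ) : ‖diffMult p a v ξ i‖ ≤ V * (L * (1 + δ ^ 2)) * bump a ‖ξ‖ i := by
  have hV : 0 ≤ V := (norm_nonneg _).trans (hv 0)
  have hL := hp.nonneg
  have h1 := ha.2.1 i
  have h2 := ha.2.1 (i + 1)
  have h3 : a (i + 1) ≤ δ ^ 2 * a i := (div_le_iff₀ h1).1 (ha2 i)
  have h4 : a i ≤ a (i + 1) := ha.monotone (by omega)
  have hδ : 1 ≤ δ ^ 2 := one_le_pow₀ ha.1.le
  rw [diffMult, norm_mul, mul_assoc V]
  refine mul_le_mul (hv i) ?_ (norm_nonneg _) hV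
  rcases min_choice (a i * ‖ξ‖) (a i * ‖ξ‖)⁻¹ with hm | hm <;> rw [bump, hm]
  · calc ‖p (a (i + 1) • ξ) - p (a i • ξ)‖
        = ‖(p (a (i + 1) • ξ) - 1) - (p (a i • ξ) - 1)‖ := by congr 1; ring
      _ ≤ L * (a (i + 1) * ‖ξ‖) + L * (a i * ‖ξ‖) :=
        (norm_sub_le _ _).trans (add_le_add (hp.norm_smul_sub_one_le h2 ξ)
          (hp.norm_smul_sub_one_le h1 ξ))
      _ ≤ L * (δ ^ 2 * a i * ‖ξ‖) + L * (a i * ‖ξ‖) := by gcongr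
      _ = _ := by ring
  · calc ‖p (a (i + 1) • ξ) - p (a i • ξ)‖
        ≤ L * (a (i + 1) * ‖ξ‖)⁻¹ + L * (a i * ‖ξ‖)⁻¹ :=
        (norm_sub_le _ _).trans (add_le_add (hp.norm_le_inv h2 hξ) (hp.norm_le_inv h1 hξ))
      _ ≤ L * (a i * ‖ξ‖)⁻¹ + L * (a i * ‖ξ‖)⁻¹ := by gcongr
      _ ≤ δ ^ 2 * (L * (a i * ‖ξ‖)⁻¹) + L * (a i * ‖ξ‖)⁻¹ := by
        have h5 : 0 ≤ L * (a i * ‖ξ‖)⁻¹ := by positivity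
        nlinarith
      _ = _ := by ring

/-- The constant bounding the individual difference multipliers. -/
noncomputable def multConst (δ V L : ℝ) : ℝ := V * (L * (1 + δ ^ 2))

theorem multConst_nonneg (hV : 0 ≤ V) (hL : 0 ≤ L) : 0 ≤ multConst δ V L := by
  unfold multConst; positivity

theorem MultBounded.norm_sum_diffMult_le (hp : MultBounded p L) (ha : IsLacunary δ a)
    (ha2 : ∀ i, a (i + 1) / a i ≤ δ ^ 2) (hv : ∀ i, ‖v i‖ ≤ V) (ξ : Eucl n) (F : Finset ℤ) :
    ‖∑ i ∈ F, diffMult p a v ξ i‖ ≤ multConst δ V L * (2 * lacConst δ) := by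
  have hV : 0 ≤ V := (norm_nonneg _).trans (hv 0)
  have hC := multConst_nonneg (δ := δ) hV hp.nonneg
  have hq := ha.lacConst_pos
  rcases eq_or_ne ξ 0 with rfl | h0
  · simp only [diffMult, smul_zero, sub_self, mul_zero, Finset.sum_const_zero, norm_zero]
    positivity
  have hξ : 0 < ‖ξ‖ := norm_pos_iff.2 h0
  calc _ ≤ ∑ i ∈ F, multConst δ V L * bump a ‖ξ‖ i :=
        norm_sum_le_of_le _ fun i _ => hp.norm_diffMult_le ha ha2 hv hξ i
    _ ≤ _ := by
        rw [← Finset.mul_sum]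
        exact mul_le_mul_of_nonneg_left (ha.sum_bump_le hξ F) hC

/-- The multiplier of `T_N - Φ_{a_N} T`, where `T_N` is the part at scales `a_N, …, a_K` of the
sum `T` over the window `[-K, K]`. -/
noncomputable def cotlarMult (p : Eucl n → ℂ) (a : ℤ → ℝ) (v : ℤ → ℂ) (K N : ℤ) (ξ : Eucl n) : ℂ :=
  ∑ i ∈ Finset.Icc N K, diffMult p a v ξ i
    - p (a N • ξ) * ∑ i ∈ Finset.Icc (-K) K, diffMult p a v ξ i

/-- The truncated multipliers are close to the smooth cut-offs `p(a_N ξ)` of the full one: for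
`a_N |ξ|` small the low scales and `1 - p` are small, for `a_N |ξ|` large the high scales and `p`
are. -/
theorem MultBounded.norm_cotlarMult_le (hp : MultBounded p L) (ha : IsLacunary δ a)
    (ha2 : ∀ i, a (i + 1) / a i ≤ δ ^ 2) (hv : ∀ i, ‖v i‖ ≤ V) {ξ : Eucl n} (hξ : 0 < ‖ξ‖)
    {K N : ℤ} (hN : -K ≤ N) (hN' : N ≤ K) :
    ‖cotlarMult p a v K N ξ‖ ≤ (1 + 3 * L) * lacConst δ * multConst δ V L * bump a ‖ξ‖ N := by
  have hV : 0 ≤ V := (norm_nonneg _).trans (hv 0)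
  have hL := hp.nonneg
  have hC := multConst_nonneg (δ := δ) hV hL
  have hq := ha.lacConst_pos
  have hN0 := ha.2.1 N
  set C := multConst δ V L with hCdef
  set q := lacConst δ with hqdef
  set σ := a N * ‖ξ‖ with hσ
  have hσ0 : 0 < σ := by positivity
  set H := ∑ i ∈ Finset.Icc N K, diffMult p a v ξ i with hH
  set W := ∑ i ∈ Finset.Ico (-K) N, diffMult p a v ξ i with hW
  have hsplit : ∑ i ∈ Finset.Icc (-K) K, diffMult p a v ξ i = W + H := by
    rw [hW, hH, ← Finset.sum_union]
    · congr 1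
      ext i
      simp only [Finset.mem_union, Finset.mem_Ico, Finset.mem_Icc]
      omega
    · rw [Finset.disjoint_left]
      intro i hi hi'
      simp only [Finset.mem_Ico, Finset.mem_Icc] at hi hi'
      omega
  have hd := fun i => hp.norm_diffMult_le ha ha2 hv hξ i
  have hH1 : ‖H‖ ≤ C * (2 * q) := hp.norm_sum_diffMult_le ha ha2 hv ξ _
  have hW1 : ‖W‖ ≤ C * (2 * q) := hp.norm_sum_diffMult_le ha ha2 hv ξ _
  have hH2 : ‖H‖ ≤ C * (q * σ⁻¹) := by
    calc ‖H‖ ≤ ∑ i ∈ Finset.Icc N K, C * ((a i)⁻¹ * ‖ξ‖⁻¹) :=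
          norm_sum_le_of_le _ fun i _ => (hd i).trans (by
            rw [← mul_inv]; exact mul_le_mul_of_nonneg_left (min_le_right _ _) hC)
      _ = C * ((∑ i ∈ Finset.Icc N K, (a i)⁻¹) * ‖ξ‖⁻¹) := by
          rw [← Finset.mul_sum, ← Finset.sum_mul]
      _ ≤ C * (q * (a N)⁻¹ * ‖ξ‖⁻¹) := by
          gcongr
          exact ha.sum_inv_le _ hN0 fun i hi => ha.monotone (Finset.mem_Icc.1 hi).1
      _ = _ := by rw [hσ, mul_inv]; ring
  have hW2 : ‖W‖ ≤ C * (q * σ) := by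
    calc ‖W‖ ≤ ∑ i ∈ Finset.Ico (-K) N, C * (a i * ‖ξ‖) :=
          norm_sum_le_of_le _ fun i _ => (hd i).trans
            (mul_le_mul_of_nonneg_left (min_le_left _ _) hC)
      _ = C * ((∑ i ∈ Finset.Ico (-K) N, a i) * ‖ξ‖) := by
          rw [← Finset.mul_sum, ← Finset.sum_mul]
      _ ≤ C * (q * a N * ‖ξ‖) := by
          gcongr
          exact ha.sum_le _ hN0.le fun i hi => ha.monotone (Finset.mem_Ico.1 hi).2.le
      _ = _ := by rw [hσ]; ring
  have hp1 : ‖p (a N • ξ) - 1‖ ≤ L * σ := hp.norm_smul_sub_one_le hN0 ξ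
  have hp2 : ‖p (a N • ξ)‖ ≤ L * σ⁻¹ := hp.norm_le_inv hN0 hξ
  have hp3 := hp.norm_le (a N • ξ)
  have hp4 : ‖p (a N • ξ) - 1‖ ≤ L + 1 := (norm_sub_le _ _).trans (by simpa using hp3)
  have hm : ‖cotlarMult p a v K N ξ‖ ≤ ‖p (a N • ξ) - 1‖ * ‖H‖ + ‖p (a N • ξ)‖ * ‖W‖ := by
    rw [cotlarMult, hsplit, ← hH, ← norm_mul, ← norm_mul]
    refine le_trans (le_of_eq ?_) (norm_add_le _ _)
    rw [← norm_neg]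
    congr 1
    ring
  refine hm.trans ?_
  rcases min_choice σ σ⁻¹ with hmin | hmin <;> rw [bump, ← hσ, hmin]
  · calc _ ≤ L * σ * (C * (2 * q)) + L * (C * (q * σ)) := by gcongr
      _ = (3 * L) * (q * C * σ) := by ring
      _ ≤ (1 + 3 * L) * (q * C * σ) := by gcongr; linarith
      _ = _ := by ring
  · calc _ ≤ (L + 1) * (C * (q * σ⁻¹)) + L * σ⁻¹ * (C * (2 * q)) := by gcongr
      _ = _ := by ring

theorem MultBounded.sum_norm_cotlarMult_sq_le (hp : MultBounded p L) (ha : IsLacunary δ a)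
    (ha2 : ∀ i, a (i + 1) / a i ≤ δ ^ 2) (hv : ∀ i, ‖v i‖ ≤ V) (ξ : Eucl n) (K : ℤ) :
    ∑ N ∈ Finset.Icc (-K) K, ‖cotlarMult p a v K N ξ‖ ^ 2 ≤
      ((1 + 3 * L) * lacConst δ * multConst δ V L) ^ 2 * (2 * lacConst δ) := by
  have hq := ha.lacConst_pos
  rcases eq_or_ne ξ 0 with rfl | h0
  · simp only [cotlarMult, diffMult, smul_zero, sub_self, mul_zero, Finset.sum_const_zero,
      norm_zero, ne_eq, OfNat.ofNat_ne_zero, not_false_eq_true, zero_pow]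
    positivity
  have hξ : 0 < ‖ξ‖ := norm_pos_iff.2 h0
  calc _ ≤ ∑ N ∈ Finset.Icc (-K) K,
        ((1 + 3 * L) * lacConst δ * multConst δ V L) ^ 2 * bump a ‖ξ‖ N := by
        refine Finset.sum_le_sum fun N hN => ?_
        rw [Finset.mem_Icc] at hN
        have h1 := hp.norm_cotlarMult_le ha ha2 hv hξ hN.1 hN.2
        have h2 := ha.bump_nonneg hξ N
        calc _ ≤ ((1 + 3 * L) * lacConst δ * multConst δ V L * bump a ‖ξ‖ N) ^ 2 := by gcongr
          _ = ((1 + 3 * L) * lacConst δ * multConst δ V L) ^ 2 *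
              (bump a ‖ξ‖ N * bump a ‖ξ‖ N) := by ring
          _ ≤ _ := by
            gcongr
            exact mul_le_of_le_one_left h2 (ha.bump_le_one _ N)
    _ ≤ _ := by
        rw [← Finset.mul_sum]
        gcongr
        exact ha.sum_bump_le hξ _

end

/-! ### Convolution with dilated Schwartz functions on the Fourier side -/

section

open FourierTransform

variable {n : ℕ}

/-- The Fourier transform of a real-valued Schwartz function. -/
noncomputable def symbol (φ : 𝓢(Eucl n, ℝ)) : 𝓢(Eucl n, ℂ) :=
  𝓕 (φ.postcompCLM Complex.ofRealCLM)

theorem symbol_apply (φ : 𝓢(Eucl n, ℝ)) (ξ : Eucl n) :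
    symbol φ ξ = ∫ y, Real.fourierChar (-inner ℝ y ξ) • (φ y : ℂ) := by
  rw [symbol, SchwartzMap.fourier_coe, Real.fourier_eq]
  rfl

theorem exists_multBounded (φ : 𝓢(Eucl n, ℝ)) (hφ : ∫ x, φ x = 1) :
    ∃ L, MultBounded (symbol φ : Eucl n → ℂ) L := by
  set S : ℝ := 2 ^ 1 * ((Finset.Iic (1, 1)).sup
      fun m => SchwartzMap.seminorm ℝ m.1 m.2) (symbol φ) with hS
  have h : ∀ k ≤ 1, ∀ m ≤ 1, ∀ ξ, (1 + ‖ξ‖) ^ k * ‖iteratedFDeriv ℝ m (symbol φ) ξ‖ ≤ S :=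
    fun k hk m hm ξ => SchwartzMap.one_add_le_sup_seminorm_apply (𝕜 := ℝ) (m := (1, 1))
      hk hm (symbol φ) ξ
  have h0 : symbol φ 0 = 1 := by
    rw [symbol_apply]
    simp only [inner_zero_right, neg_zero, AddChar.map_zero_eq_one, one_smul]
    rw [integral_complex_ofReal, hφ, Complex.ofReal_one]
  refine ⟨S, fun ξ => ?_, fun ξ => ?_, fun ξ => ?_⟩
  · simpa using h 0 zero_le_one 0 zero_le_one ξ
  · have := h 1 le_rfl 0 zero_le_one ξ
    rw [pow_one, norm_iteratedFDeriv_zero] at this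
    nlinarith [norm_nonneg (symbol φ ξ)]
  · have hder : ∀ z ∈ (Set.univ : Set (Eucl n)), ‖fderiv ℝ (symbol φ) z‖ ≤ S := fun z _ => by
      have := h 0 zero_le_one 1 le_rfl z
      rwa [pow_zero, one_mul, norm_iteratedFDeriv_one] at this
    have := convex_univ.norm_image_sub_le_of_norm_fderiv_le (𝕜 := ℝ)
      (fun z _ => (symbol φ).differentiable z) hder (Set.mem_univ 0) (Set.mem_univ ξ)
    rwa [h0, sub_zero] at this

theorem exists_schwartz_dilation (φ : 𝓢(Eucl n, ℝ)) {t : ℝ} (ht : 0 < t) :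
    ∃ k : 𝓢(Eucl n, ℂ), (∀ x, k x = (dilation φ t x : ℂ)) ∧ ∀ ξ, 𝓕 k ξ = symbol φ (t • ξ) := by
  set e : Eucl n ≃L[ℝ] Eucl n := ContinuousLinearEquiv.smulLeft (Units.mk0 t⁻¹ (by positivity))
  set k : 𝓢(Eucl n, ℂ) := ((t ^ n)⁻¹ : ℂ) •
    SchwartzMap.compCLMOfContinuousLinearEquiv ℂ e (φ.postcompCLM Complex.ofRealCLM) with hk
  have hkx : ∀ x, k x = (dilation φ t x : ℂ) := fun x => by
    rw [hk, dilation]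
    push_cast
    rfl
  refine ⟨k, hkx, fun ξ => ?_⟩
  rw [SchwartzMap.fourier_coe, Real.fourier_eq, symbol_apply]
  set F : Eucl n → ℂ := fun w => Real.fourierChar (-inner ℝ w (t • ξ)) • (φ w : ℂ) with hF
  have h1 : ∀ y : Eucl n, Real.fourierChar (-inner ℝ y ξ) • k y
      = ((t ^ n)⁻¹ : ℝ) • F (t⁻¹ • y) := fun y => by
    simp only [hkx, hF, dilation, inner_smul_left, inner_smul_right]
    rw [smul_comm]
    congr 1
    · congr 3
      simp [ht.ne']
    · push_cast; simp
  simp only [h1]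
  rw [integral_smul, Measure.integral_comp_inv_smul_of_nonneg _ _ ht.le, smul_smul,
    finrank_euclideanSpace_fin, inv_mul_cancel₀ (by positivity), one_smul]

theorem exists_schwartz_convOp (φ : 𝓢(Eucl n, ℝ)) {t : ℝ} (ht : 0 < t) (g : 𝓢(Eucl n, ℂ)) :
    ∃ h : 𝓢(Eucl n, ℂ), (∀ x, h x = convOp φ t g x) ∧
      ∀ ξ, 𝓕 h ξ = symbol φ (t • ξ) * 𝓕 g ξ := by
  obtain ⟨k, hk, hkF⟩ := exists_schwartz_dilation φ ht
  refine ⟨SchwartzMap.convolution (ContinuousLinearMap.mul ℂ ℂ) k g, fun x => ?_, fun ξ => ?_⟩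
  · rw [SchwartzMap.convolution_apply, convOp_apply, convolution_eq_swap]
    refine integral_congr_ae (Filter.Eventually.of_forall fun z => ?_)
    simp [hk]
  · rw [SchwartzMap.fourier_convolution, SchwartzMap.pairing_apply_apply, hkF]
    rfl

theorem lintegral_enorm_sq_fourier (h : 𝓢(Eucl n, ℂ)) :
    ∫⁻ ξ, ‖𝓕 h ξ‖ₑ ^ 2 = ∫⁻ x, ‖h x‖ₑ ^ 2 := by
  have key : ∀ k : 𝓢(Eucl n, ℂ), ∫⁻ x, ‖k x‖ₑ ^ 2 = ENNReal.ofReal (∫ x, ‖k x‖ ^ 2) := by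
    intro k
    have hi : Integrable fun x => ‖k x‖ ^ 2 :=
      (memLp_two_iff_integrable_sq_norm k.continuous.aestronglyMeasurable).1 (k.memLp 2)
    rw [ofReal_integral_eq_lintegral_ofReal hi
      (Filter.Eventually.of_forall fun x => by positivity)]
    refine lintegral_congr fun x => ?_
    rw [ENNReal.ofReal_pow (norm_nonneg _), ofReal_norm]
  rw [key, key, SchwartzMap.integral_norm_sq_fourier]

/-- The convolution with a dilation of `φ` is dominated by the maximal function. -/
theorem PoissonBounded.enorm_convOp_le_hlMax {φ : Eucl n → ℝ} {A : ℝ} (hφ : PoissonBounded φ A)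
    {t : ℝ} (ht : 0 < t) {g : Eucl n → ℂ} (hg : AEStronglyMeasurable g) (x : Eucl n) :
    ‖convOp φ t g x‖ₑ ≤ hlMax (fun z => 2 * ENNReal.ofReal A * weightConst n * ‖g z‖ₑ) x := by
  have hc : 2 * ENNReal.ofReal A * weightConst n ≠ ∞ :=
    ENNReal.mul_ne_top (by finiteness) (weightConst_ne_top n)
  set M := hlMax (fun z => 2 * ENNReal.ofReal A * weightConst n * ‖g z‖ₑ) x with hM
  have h1 : ∀ k : ℕ, 2 * ENNReal.ofReal A * weightConst n *
      ballAvg (fun z => ‖g z‖ₑ) x (2 ^ k * t) ≤ M := fun k => by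
    refine le_trans (le_of_eq ?_) (ballAvg_le_hlMax _ x (r := 2 ^ k * t) (by positivity))
    rw [ballAvg, ballAvg, lintegral_const_mul' _ _ hc]
    ring
  rw [convOp_apply]
  calc _ ≤ ENNReal.ofReal A * ∫⁻ z, ENNReal.ofReal (poissonWeight n t ‖x - z‖) * ‖g z‖ₑ :=
        (enorm_integral_le_lintegral_enorm _).trans
          (enorm_integral_smul_le hφ.pos.le fun z => hφ.abs_dilation_le ht _)
    _ ≤ ENNReal.ofReal A * (weightConst n *
        ∑' k : ℕ, (2⁻¹ : ℝ≥0∞) ^ k * ballAvg (fun z => ‖g z‖ₑ) x (2 ^ k * t)) := by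
        gcongr
        exact lintegral_poissonWeight_mul_le ht x hg.enorm
    _ = ∑' k : ℕ, (2⁻¹ : ℝ≥0∞) ^ (k + 1) * (2 * ENNReal.ofReal A * weightConst n *
        ballAvg (fun z => ‖g z‖ₑ) x (2 ^ k * t)) := by
        rw [← mul_assoc, ← ENNReal.tsum_mul_left]
        refine tsum_congr fun k => ?_
        rw [pow_succ, show ∀ u b w y : ℝ≥0∞, u * 2⁻¹ * (2 * b * w * y) = (2⁻¹ * 2) * (b * w * (u * y))
          from fun u b w y => by ring, ENNReal.inv_mul_cancel two_ne_zero ENNReal.ofNat_ne_top,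
          one_mul]
    _ ≤ ∑' k : ℕ, (2⁻¹ : ℝ≥0∞) ^ (k + 1) * M := by gcongr with k; exact h1 k
    _ = M := by
        rw [ENNReal.tsum_mul_right]
        simp_rw [pow_succ]
        rw [ENNReal.tsum_mul_right, ENNReal.tsum_geometric, ENNReal.one_sub_inv_two, inv_inv,
          ENNReal.mul_inv_cancel two_ne_zero ENNReal.ofNat_ne_top, one_mul]

/-! ### The maximal differential transform on `L²` -/

/-- The bound for the square of the maximal differential transform on `L²`. -/
noncomputable def maxConst (n : ℕ) (δ V L A : ℝ) : ℝ≥0∞ :=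
  32 * (ENNReal.ofReal (((1 + 3 * L) * lacConst δ * multConst δ V L) ^ 2 * (2 * lacConst δ)) +
    ENNReal.ofReal (8 * 5 ^ n) * ((2 * ENNReal.ofReal A * weightConst n) ^ 2 *
      ENNReal.ofReal (multConst δ V L * (2 * lacConst δ)) ^ 2))

theorem maxConst_ne_top (n : ℕ) (δ V L A : ℝ) : maxConst n δ V L A ≠ ∞ := by
  have := weightConst_ne_top n
  unfold maxConst
  finiteness

variable {φ : 𝓢(Eucl n, ℝ)} {δ V L A : ℝ} {a : ℤ → ℝ} {v : ℤ → ℂ}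

/-- Cotlar-type decomposition in a finite window of scales: the truncated sums `T_N` differ from
the averages `Φ_{a_N} T` of the full sum by terms that are square summable by Plancherel's
theorem, and the averages are controlled by the maximal function of `T`. -/
theorem lintegral_iSup_window_le (hn : 1 ≤ n) (hA : PoissonBounded (φ : Eucl n → ℝ) A)
    (hp : MultBounded (symbol φ : Eucl n → ℂ) L) (ha : IsLacunary δ a)
    (ha2 : ∀ i, a (i + 1) / a i ≤ δ ^ 2) (hv : ∀ i, ‖v i‖ ≤ V) (g : 𝓢(Eucl n, ℂ)) (K : ℤ) :
    ∫⁻ x, (⨆ N₁ ∈ Finset.Icc (-K) K, ⨆ N₂ ∈ Finset.Icc (-K) K,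
      ‖diffTransform φ a v N₁ N₂ g x‖ₑ ^ 2) ≤ maxConst n δ V L A * ∫⁻ x, ‖g x‖ₑ ^ 2 := by
  choose P hP hPF using fun (i : ℤ) (g : 𝓢(Eucl n, ℂ)) => exists_schwartz_convOp φ (ha.2.1 i) g
  set T : ℤ → 𝓢(Eucl n, ℂ) := fun N => ∑ i ∈ Finset.Icc N K, v i • (P (i + 1) g - P i g) with hT
  have hTx : ∀ N x, T N x = diffTransform φ a v N K g x := fun N x => by
    simp [hT, diffTransform, hP]
  have hTF : ∀ N ξ, 𝓕 (T N) ξ = (∑ i ∈ Finset.Icc N K, diffMult (symbol φ) a v ξ i) * 𝓕 g ξ := by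
    intro N ξ
    have h1 : 𝓕 (T N) = ∑ i ∈ Finset.Icc N K, v i • (𝓕 (P (i + 1) g) - 𝓕 (P i g)) := by
      have := map_sum (fourierCLM ℂ 𝓢(Eucl n, ℂ)) (fun i => v i • (P (i + 1) g - P i g))
        (Finset.Icc N K)
      simpa only [map_smul, map_sub, fourierCLM_apply] using this
    rw [h1]
    simp only [sum_apply, smul_apply, sub_apply, hPF,
      Finset.sum_mul, diffMult, smul_eq_mul]
    exact Finset.sum_congr rfl fun i _ => by ring
  set D : ℤ → 𝓢(Eucl n, ℂ) := fun N => T N - P N (T (-K)) with hD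
  have hDF : ∀ N ξ, 𝓕 (D N) ξ = cotlarMult (symbol φ) a v K N ξ * 𝓕 g ξ := by
    intro N ξ
    have h1 : 𝓕 (D N) = 𝓕 (T N) - 𝓕 (P N (T (-K))) := by
      have := map_sub (fourierCLM ℂ 𝓢(Eucl n, ℂ)) (T N) (P N (T (-K)))
      simpa only [fourierCLM_apply] using this
    rw [h1, sub_apply, hPF, hTF, hTF, cotlarMult]
    ring
  set G : Eucl n → ℝ≥0∞ := fun x => ⨆ N ∈ Finset.Icc (-K) K, ‖P N (T (-K)) x‖ₑ with hG
  set Q : Eucl n → ℝ≥0∞ := fun x => ∑ N ∈ Finset.Icc (-K) K, ‖D N x‖ₑ ^ 2 + G x ^ 2 with hQ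
  have hTQ : ∀ N x, -K ≤ N → ‖T N x‖ₑ ^ 2 ≤ 4 * Q x := by
    intro N x hN
    by_cases hNK : N ≤ K
    · have hmem : N ∈ Finset.Icc (-K) K := Finset.mem_Icc.2 ⟨hN, hNK⟩
      calc ‖T N x‖ₑ ^ 2 = ‖D N x + P N (T (-K)) x‖ₑ ^ 2 := by simp [hD]
        _ ≤ (‖D N x‖ₑ + G x) ^ 2 := by
          gcongr
          refine (enorm_add_le _ _).trans (add_le_add le_rfl ?_)
          exact le_iSup₂_of_le N hmem le_rfl
        _ ≤ 4 * (‖D N x‖ₑ ^ 2 + G x ^ 2) := ENNReal.add_sq_le_four_mul _ _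
        _ ≤ _ := by
          simp only [hQ]
          gcongr
          exact Finset.single_le_sum (f := fun N => ‖D N x‖ₑ ^ 2) (fun _ _ => zero_le) hmem
    · rw [hT]
      simp only [Finset.Icc_eq_empty hNK, Finset.sum_empty]
      simp
  have hsup : ∀ x, (⨆ N₁ ∈ Finset.Icc (-K) K, ⨆ N₂ ∈ Finset.Icc (-K) K,
      ‖diffTransform φ a v N₁ N₂ g x‖ₑ ^ 2) ≤ 32 * Q x := by
    intro x
    refine iSup₂_le fun N₁ h1 => iSup₂_le fun N₂ h2 => ?_
    rw [Finset.mem_Icc] at h1 h2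
    by_cases h12 : N₁ ≤ N₂
    · have hdiff : diffTransform φ a v N₁ N₂ g x = T N₁ x - T (N₂ + 1) x := by
        rw [hTx, hTx, eq_sub_iff_add_eq]
        simp only [diffTransform]
        rw [← Finset.sum_union]
        · congr 1
          ext i
          simp only [Finset.mem_union, Finset.mem_Icc]
          omega
        · rw [Finset.disjoint_left]
          intro i hi hi'
          simp only [Finset.mem_Icc] at hi hi'
          omega
      calc _ = ‖T N₁ x - T (N₂ + 1) x‖ₑ ^ 2 := by rw [hdiff]
        _ ≤ (‖T N₁ x‖ₑ + ‖T (N₂ + 1) x‖ₑ) ^ 2 := by gcongr; exact enorm_sub_le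
        _ ≤ 4 * (‖T N₁ x‖ₑ ^ 2 + ‖T (N₂ + 1) x‖ₑ ^ 2) := ENNReal.add_sq_le_four_mul _ _
        _ ≤ 4 * (4 * Q x + 4 * Q x) := by
          gcongr
          · exact hTQ _ _ h1.1
          · exact hTQ _ _ (by omega)
        _ = _ := by ring
    · simp [diffTransform, Finset.Icc_eq_empty h12]
  have hGm : Measurable G := Measurable.biSup _ (Finset.countable_toSet _)
    fun N _ => (P N (T (-K))).continuous.enorm.measurable
  have hDint : ∫⁻ x, ∑ N ∈ Finset.Icc (-K) K, ‖D N x‖ₑ ^ 2 ≤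
      ENNReal.ofReal (((1 + 3 * L) * lacConst δ * multConst δ V L) ^ 2 * (2 * lacConst δ)) *
        ∫⁻ x, ‖g x‖ₑ ^ 2 := by
    rw [lintegral_finsetSum _ fun N _ => (D N).continuous.enorm.measurable.pow_const 2]
    simp_rw [← lintegral_enorm_sq_fourier (D _)]
    rw [← lintegral_finsetSum _ fun N _ => (𝓕 (D N)).continuous.enorm.measurable.pow_const 2,
      ← lintegral_enorm_sq_fourier g, ← lintegral_const_mul' _ _ ENNReal.ofReal_ne_top]
    refine lintegral_mono fun ξ => ?_
    have hmul : ∀ N, ‖𝓕 (D N) ξ‖ₑ ^ 2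
        = ‖cotlarMult (symbol φ) a v K N ξ‖ₑ ^ 2 * ‖𝓕 g ξ‖ₑ ^ 2 := fun N => by
      rw [hDF, enorm_mul, mul_pow]
    simp only [hmul]
    rw [← Finset.sum_mul]
    gcongr
    refine le_trans (le_of_eq ?_)
      (ENNReal.ofReal_le_ofReal (hp.sum_norm_cotlarMult_sq_le ha ha2 hv ξ K))
    rw [ENNReal.ofReal_sum_of_nonneg fun _ _ => by positivity]
    refine Finset.sum_congr rfl fun N _ => ?_
    rw [ENNReal.ofReal_pow (norm_nonneg _), ofReal_norm]
  have hTint : ∫⁻ x, ‖T (-K) x‖ₑ ^ 2 ≤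
      ENNReal.ofReal (multConst δ V L * (2 * lacConst δ)) ^ 2 * ∫⁻ x, ‖g x‖ₑ ^ 2 := by
    rw [← lintegral_enorm_sq_fourier, ← lintegral_enorm_sq_fourier g,
      ← lintegral_const_mul' _ _ (by finiteness)]
    refine lintegral_mono fun ξ => ?_
    simp only [hTF, enorm_mul, mul_pow]
    gcongr
    rw [← ofReal_norm]
    exact ENNReal.ofReal_le_ofReal (hp.norm_sum_diffMult_le ha ha2 hv ξ _)
  have hGint : ∫⁻ x, G x ^ 2 ≤ ENNReal.ofReal (8 * 5 ^ n) *
      ((2 * ENNReal.ofReal A * weightConst n) ^ 2 *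
      ∫⁻ x, ‖T (-K) x‖ₑ ^ 2) := by
    have hw := weightConst_ne_top n
    rw [← lintegral_const_mul' _ _ (by finiteness)]
    simp_rw [← mul_pow]
    refine lintegral_sq_le_of_le_hlMax hn ((T (-K)).continuous.enorm.measurable.const_mul _) hGm
      fun x => iSup₂_le fun N _ => ?_
    rw [hP]
    exact hA.enorm_convOp_le_hlMax (ha.2.1 N) (T (-K)).continuous.aestronglyMeasurable x
  calc _ ≤ ∫⁻ x, 32 * Q x := lintegral_mono hsup
    _ = 32 * ((∫⁻ x, ∑ N ∈ Finset.Icc (-K) K, ‖D N x‖ₑ ^ 2) + ∫⁻ x, G x ^ 2) := by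
        rw [lintegral_const_mul' _ _ (by finiteness), hQ,
          lintegral_add_right _ (hGm.pow_const 2)]
    _ ≤ 32 * (ENNReal.ofReal (((1 + 3 * L) * lacConst δ * multConst δ V L) ^ 2 *
          (2 * lacConst δ)) * (∫⁻ x, ‖g x‖ₑ ^ 2) + ENNReal.ofReal (8 * 5 ^ n) *
          ((2 * ENNReal.ofReal A * weightConst n) ^ 2 *
          (ENNReal.ofReal (multConst δ V L * (2 * lacConst δ)) ^ 2 * ∫⁻ x, ‖g x‖ₑ ^ 2))) := by
        gcongr
        exact hGint.trans (by gcongr)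
    _ = _ := by rw [maxConst]; ring

end

section

variable {n : ℕ} {φ : 𝓢(Eucl n, ℝ)} {δ V L A : ℝ} {a : ℤ → ℝ} {v : ℤ → ℂ}

theorem measurable_diffTransform_schwartz (ha : IsLacunary δ a) (g : 𝓢(Eucl n, ℂ)) (N₁ N₂ : ℤ) :
    Measurable fun x => ‖diffTransform φ a v N₁ N₂ g x‖ₑ ^ 2 := by
  have h : ∀ i, Continuous (convOp φ (a i) g) := fun i => by
    obtain ⟨k, hk, -⟩ := exists_schwartz_convOp φ (ha.2.1 i) g
    rw [← funext hk]
    exact k.continuous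
  have h2 : Continuous fun x => diffTransform φ a v N₁ N₂ g x :=
    continuous_finsetSum _ fun i _ => continuous_const.mul ((h _).sub (h _))
  exact h2.enorm.measurable.pow_const 2

theorem lintegral_iSup_schwartz_le (hn : 1 ≤ n) (hA : PoissonBounded (φ : Eucl n → ℝ) A)
    (hp : MultBounded (symbol φ : Eucl n → ℂ) L) (ha : IsLacunary δ a)
    (ha2 : ∀ i, a (i + 1) / a i ≤ δ ^ 2) (hv : ∀ i, ‖v i‖ ≤ V) (g : 𝓢(Eucl n, ℂ)) :
    ∫⁻ x, (⨆ (N₁ : ℤ) (N₂ : ℤ), ‖diffTransform φ a v N₁ N₂ g x‖ₑ ^ 2) ≤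
      maxConst n δ V L A * ∫⁻ x, ‖g x‖ₑ ^ 2 := by
  set W : ℕ → Eucl n → ℝ≥0∞ := fun K x => ⨆ N₁ ∈ Finset.Icc (-(K : ℤ)) K,
    ⨆ N₂ ∈ Finset.Icc (-(K : ℤ)) K, ‖diffTransform φ a v N₁ N₂ g x‖ₑ ^ 2 with hW
  have hWm : ∀ K, Measurable (W K) := fun K => Measurable.biSup _ (Finset.countable_toSet _)
    fun N₁ _ => Measurable.biSup _ (Finset.countable_toSet _)
    fun N₂ _ => measurable_diffTransform_schwartz ha g N₁ N₂
  have hmono : Monotone W := by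
    intro K K' hK x
    have hsub : ∀ N : ℤ, N ∈ Finset.Icc (-(K : ℤ)) K → N ∈ Finset.Icc (-(K' : ℤ)) K' := by
      intro N hN
      simp only [Finset.mem_Icc] at hN ⊢
      omega
    exact iSup₂_le fun N₁ h1 => iSup₂_le fun N₂ h2 =>
      le_iSup₂_of_le N₁ (hsub _ h1) (le_iSup₂_of_le N₂ (hsub _ h2) le_rfl)
  calc _ ≤ ∫⁻ x, ⨆ K, W K x := by
        refine lintegral_mono fun x => iSup_le fun N₁ => iSup_le fun N₂ => ?_
        refine le_iSup_of_le (N₁.natAbs + N₂.natAbs) ?_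
        exact le_iSup₂_of_le N₁ (Finset.mem_Icc.2 ⟨by omega, by omega⟩)
          (le_iSup₂_of_le N₂ (Finset.mem_Icc.2 ⟨by omega, by omega⟩) le_rfl)
    _ = ⨆ K, ∫⁻ x, W K x := lintegral_iSup hWm hmono
    _ ≤ _ := iSup_le fun K => lintegral_iSup_window_le hn hA hp ha ha2 hv g K

/-- Convolution with a dilation of `φ` turns `L²` convergence into pointwise convergence. -/
theorem tendsto_convOp {t : ℝ} (ht : 0 < t) {g : Eucl n → ℂ} (hg : MemLp g 2)
    {h : ℕ → Eucl n → ℂ} (hh : ∀ k, MemLp (h k) 2)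
    (hlim : Filter.Tendsto (fun k => eLpNorm (h k - g) 2) Filter.atTop (nhds 0)) (x : Eucl n) :
    Filter.Tendsto (fun k => convOp φ t (h k) x) Filter.atTop (nhds (convOp φ t g x)) := by
  obtain ⟨k, hk, -⟩ := exists_schwartz_dilation φ ht
  set κ : Eucl n → ℂ := fun z => k (x - z) with hκ
  have hκ2 : MemLp κ 2 :=
    (k.memLp 2).comp_measurePreserving (Measure.measurePreserving_sub_left volume x)
  have hconv : ∀ f : Eucl n → ℂ, convOp φ t f x = ∫ z, (κ • f) z := fun f => by
    rw [convOp_apply]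
    refine integral_congr_ae (Filter.Eventually.of_forall fun z => ?_)
    simp [hκ, hk]
  simp only [hconv]
  refine tendsto_integral_of_L1' _ (hg.smul hκ2 (r := 1)).aestronglyMeasurable
    (Filter.Eventually.of_forall fun j => memLp_one_iff_integrable.1 ((hh j).smul hκ2 (r := 1))) ?_
  have hlim2 : Filter.Tendsto (fun j => eLpNorm κ 2 * eLpNorm (h j - g) 2) Filter.atTop
      (nhds 0) := by
    simpa using ENNReal.Tendsto.const_mul hlim (Or.inr hκ2.eLpNorm_ne_top)
  refine tendsto_of_tendsto_of_tendsto_of_le_of_le tendsto_const_nhds hlim2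
    (fun _ => zero_le) fun j => ?_
  rw [← smul_sub]
  exact eLpNorm_smul_le_mul_eLpNorm ((hh j).sub hg).aestronglyMeasurable hκ2.aestronglyMeasurable

theorem lintegral_enorm_sq_eq (g : Eucl n → ℂ) : ∫⁻ x, ‖g x‖ₑ ^ 2 = eLpNorm g 2 ^ 2 := by
  have := eLpNorm_nnreal_pow_eq_lintegral (f := g) (μ := volume) (p := 2) two_ne_zero
  simpa using this.symm

theorem exists_schwartz_approx {g : Eucl n → ℂ} (hg : MemLp g 2) {ε : ℝ} (hε : 0 < ε) :
    ∃ h : 𝓢(Eucl n, ℂ), eLpNorm ((h : Eucl n → ℂ) - g) 2 ≤ ENNReal.ofReal ε := by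
  obtain ⟨h, h1, h2, h3⟩ := MemLp.exist_eLpNorm_sub_le (by simp) one_le_two hg hε
  refine ⟨h1.toSchwartzMap h2, ?_⟩
  rw [eLpNorm_sub_comm]
  exact h3

theorem eLpNorm_two_le_add_sub {f g : Eucl n → ℂ} (hf : AEStronglyMeasurable f)
    (hg : AEStronglyMeasurable g) : eLpNorm f 2 ≤ eLpNorm g 2 + eLpNorm (f - g) 2 := by
  have := eLpNorm_add_le hg (hf.sub hg) one_le_two
  rwa [add_sub_cancel] at this

theorem exists_schwartz_seq {g : Eucl n → ℂ} (hg : MemLp g 2) :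
    ∃ h : ℕ → 𝓢(Eucl n, ℂ),
      Filter.Tendsto (fun k => eLpNorm ((h k : Eucl n → ℂ) - g) 2) Filter.atTop (nhds 0) := by
  choose h hh using fun k : ℕ => exists_schwartz_approx hg (ε := 1 / (k + 1)) (by positivity)
  have hε : Filter.Tendsto (fun k : ℕ => ENNReal.ofReal (1 / (k + 1 : ℝ))) Filter.atTop
      (nhds 0) := by
    have := (ENNReal.continuous_ofReal.tendsto 0).comp
      (tendsto_one_div_add_atTop_nhds_zero_nat (𝕜 := ℝ))
    simpa [Function.comp_def] using this
  exact ⟨h, tendsto_of_tendsto_of_tendsto_of_le_of_le tendsto_const_nhds hε (fun _ => zero_le) hh⟩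

theorem tendsto_diffTransform (ha : IsLacunary δ a) {g : Eucl n → ℂ} (hg : MemLp g 2)
    {h : ℕ → Eucl n → ℂ} (hh : ∀ k, MemLp (h k) 2)
    (hlim : Filter.Tendsto (fun k => eLpNorm (h k - g) 2) Filter.atTop (nhds 0))
    (N₁ N₂ : ℤ) (x : Eucl n) :
    Filter.Tendsto (fun k => ‖diffTransform φ a v N₁ N₂ (h k) x‖ₑ ^ 2) Filter.atTop
      (nhds (‖diffTransform φ a v N₁ N₂ g x‖ₑ ^ 2)) := by
  refine ((ENNReal.continuous_pow 2).tendsto _).comp (Filter.Tendsto.enorm ?_)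
  have hc := fun i => tendsto_convOp (φ := φ) (ha.2.1 i) hg hh hlim x
  exact tendsto_finsetSum _ fun i _ => ((hc _).sub (hc _)).const_mul _

/-- The maximal differential transform is bounded on `L²`. -/
theorem lintegral_iSup_diffTransform_le (hn : 1 ≤ n) (hA : PoissonBounded (φ : Eucl n → ℝ) A)
    (hp : MultBounded (symbol φ : Eucl n → ℂ) L) (ha : IsLacunary δ a)
    (ha2 : ∀ i, a (i + 1) / a i ≤ δ ^ 2) (hv : ∀ i, ‖v i‖ ≤ V) {g : Eucl n → ℂ}
    (hg : MemLp g 2) :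
    ∫⁻ x, (⨆ (N₁ : ℤ) (N₂ : ℤ), ‖diffTransform φ a v N₁ N₂ g x‖ₑ ^ 2) ≤
      maxConst n δ V L A * ∫⁻ x, ‖g x‖ₑ ^ 2 := by
  obtain ⟨h, hlim⟩ := exists_schwartz_seq hg
  have hD := tendsto_diffTransform (φ := φ) (v := v) ha hg (fun k => (h k).memLp 2) hlim
  have hbound : ∀ k, ∫⁻ x, (⨆ (N₁ : ℤ) (N₂ : ℤ), ‖diffTransform φ a v N₁ N₂ (h k) x‖ₑ ^ 2) ≤
      maxConst n δ V L A * (eLpNorm g 2 + eLpNorm ((h k : Eucl n → ℂ) - g) 2) ^ 2 := fun k => by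
    refine (lintegral_iSup_schwartz_le hn hA hp ha ha2 hv (h k)).trans ?_
    rw [lintegral_enorm_sq_eq]
    exact mul_le_mul' le_rfl (pow_le_pow_left' (eLpNorm_two_le_add_sub
      (h k).continuous.aestronglyMeasurable hg.aestronglyMeasurable) 2)
  have hlimbound : Filter.Tendsto (fun k : ℕ => maxConst n δ V L A *
      (eLpNorm g 2 + eLpNorm ((h k : Eucl n → ℂ) - g) 2) ^ 2) Filter.atTop
      (nhds (maxConst n δ V L A * eLpNorm g 2 ^ 2)) := by
    refine ENNReal.Tendsto.const_mul ?_ (Or.inr (maxConst_ne_top n δ V L A))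
    have := ((ENNReal.continuous_pow 2).tendsto _).comp (hlim.const_add (eLpNorm g 2))
    rwa [add_zero] at this
  rw [lintegral_enorm_sq_eq g, ← hlimbound.liminf_eq]
  refine le_trans ?_ (Filter.liminf_le_liminf (Filter.Eventually.of_forall hbound))
  refine le_trans ?_ (lintegral_liminf_le fun k => Measurable.iSup fun N₁ =>
    Measurable.iSup fun N₂ => measurable_diffTransform_schwartz ha (h k) N₁ N₂)
  refine lintegral_mono fun x => iSup_le fun N₁ => iSup_le fun N₂ => ?_
  rw [← (hD N₁ N₂ x).liminf_eq]
  exact Filter.liminf_le_liminf (Filter.Eventually.of_forall fun k =>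
    le_iSup_of_le N₁ (le_iSup_of_le N₂ le_rfl))

end

/-! ### The pointwise comparison of the maximal transform at two points of a ball -/

section

variable {n : ℕ} {φ : Eucl n → ℝ} {δ V A : ℝ} {a : ℤ → ℝ} {v : ℤ → ℂ} {f : Eucl n → ℂ}

/-- A lacunary sequence splits an interval of indices at any threshold `r`. -/
theorem IsLacunary.exists_split (ha : IsLacunary δ a) (r : ℝ) (N₁ N₂ : ℤ) (h12 : N₁ ≤ N₂) :
    ∃ m : ℤ, N₁ ≤ m + 1 ∧ m ≤ N₂ ∧ (∀ i ∈ Finset.Icc N₁ m, a i < r) ∧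
      ∀ i ∈ Finset.Icc (m + 1) N₂, r ≤ a i := by
  rcases ((Finset.Icc N₁ N₂).filter fun i => r ≤ a i).eq_empty_or_nonempty with he | hne
  · refine ⟨N₂, by omega, le_rfl, fun i hi => ?_, fun i hi => ?_⟩
    · exact not_le.1 (Finset.filter_eq_empty_iff.1 he hi)
    · rw [Finset.mem_Icc] at hi; omega
  · set m := Finset.min' _ hne with hm
    have hmem := Finset.min'_mem _ hne
    rw [← hm, Finset.mem_filter, Finset.mem_Icc] at hmem
    refine ⟨m - 1, by omega, by omega, fun i hi => ?_, fun i hi => ?_⟩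
    · rw [Finset.mem_Icc] at hi
      by_contra! hcon
      have hiN : i ≤ N₂ := by omega
      have := Finset.min'_le ((Finset.Icc N₁ N₂).filter fun i => r ≤ a i) i
        (Finset.mem_filter.2 ⟨Finset.mem_Icc.2 ⟨hi.1, hiN⟩, hcon⟩)
      omega
    · rw [Finset.mem_Icc] at hi
      exact hmem.2.trans (ha.monotone (by omega))

theorem diffTransform_eq_add {N₁ N₂ m : ℤ} (h1 : N₁ ≤ m + 1) (h2 : m ≤ N₂) (x : Eucl n) :
    diffTransform φ a v N₁ N₂ f x
      = diffTransform φ a v N₁ m f x + diffTransform φ a v (m + 1) N₂ f x := by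
  simp only [diffTransform]
  rw [← Finset.sum_union]
  · congr 1
    ext i
    simp only [Finset.mem_union, Finset.mem_Icc]
    omega
  · rw [Finset.disjoint_left]
    intro i hi hi'
    simp only [Finset.mem_Icc] at hi hi'
    omega

theorem enorm_le_ofReal_of_norm_le {z : ℂ} (h : ‖z‖ ≤ V) : ‖z‖ₑ ≤ ENNReal.ofReal V := by
  rw [← ofReal_norm]; exact ENNReal.ofReal_le_ofReal h

/-- The part of the transform at scales at least `r` is nearly constant on balls of radius `r`. -/
theorem enorm_diffTransform_sub_le_of_le (hφ : PoissonBounded φ A) (h1 : ∫ x, φ x = 1)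
    (hf : MemBMO f) (ha : IsLacunary δ a) (hv : ∀ i, ‖v i‖ ≤ V) {c x y : Eucl n} {r : ℝ}
    (hr : 0 < r) (hx : x ∈ ball c r) (hy : y ∈ ball c r) {N₁ N₂ : ℤ}
    (hN : ∀ i ∈ Finset.Icc N₁ N₂, r ≤ a i) :
    ‖diffTransform φ a v N₁ N₂ f x - diffTransform φ a v N₁ N₂ f y‖ₑ ≤
      ENNReal.ofReal (4 * V * A * lacConst δ) * (bmoConst n * bmoNorm f) := by
  have hV : 0 ≤ V := (norm_nonneg _).trans (hv 0)
  have hA := hφ.pos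
  have hxy : ‖x - y‖ ≤ 2 * r := by
    rw [← dist_eq_norm]
    have := dist_triangle_right x y c
    rw [mem_ball] at hx hy
    linarith
  have hterm : ∀ i, r ≤ a i → ∀ t, a i ≤ t → ‖convOp φ t f x - convOp φ t f y‖ₑ ≤
      ENNReal.ofReal (2 * A * r * (a i)⁻¹) * (bmoConst n * bmoNorm f) := by
    intro i hi t ht
    have hai := ha.2.1 i
    have ht0 : 0 < t := hai.trans_le ht
    refine (enorm_convOp_sub_convOp_le hφ h1 hf ht0 (hxy.trans (by linarith))).trans ?_
    gcongr ENNReal.ofReal ?_ * _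
    calc A * (‖x - y‖ / t) ≤ A * (2 * r / a i) := by gcongr
      _ = _ := by ring
  calc _ = ‖∑ i ∈ Finset.Icc N₁ N₂, v i * ((convOp φ (a (i + 1)) f x - convOp φ (a (i + 1)) f y)
        - (convOp φ (a i) f x - convOp φ (a i) f y))‖ₑ := by
        simp only [diffTransform]
        rw [← Finset.sum_sub_distrib]
        congr 1
        exact Finset.sum_congr rfl fun i _ => by ring
    _ ≤ ∑ i ∈ Finset.Icc N₁ N₂, ENNReal.ofReal (4 * V * A * r * (a i)⁻¹) *
        (bmoConst n * bmoNorm f) := by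
        refine (enorm_sum_le _ _).trans (Finset.sum_le_sum fun i hi => ?_)
        have hai := ha.2.1 i
        rw [enorm_mul]
        calc _ ≤ ENNReal.ofReal V * (ENNReal.ofReal (2 * A * r * (a i)⁻¹) *
              (bmoConst n * bmoNorm f) + ENNReal.ofReal (2 * A * r * (a i)⁻¹) *
              (bmoConst n * bmoNorm f)) := by
              refine mul_le_mul' (enorm_le_ofReal_of_norm_le (hv i)) (enorm_sub_le.trans
                (add_le_add (hterm i (hN i hi) _ (ha.monotone (by omega)))
                  (hterm i (hN i hi) _ le_rfl)))
          _ = _ := by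
              rw [show 4 * V * A * r * (a i)⁻¹ = V * (2 * (2 * A * r * (a i)⁻¹)) by ring,
                ENNReal.ofReal_mul hV, ENNReal.ofReal_mul zero_le_two, ENNReal.ofReal_ofNat]
              ring
    _ = ENNReal.ofReal (4 * V * A * r * ∑ i ∈ Finset.Icc N₁ N₂, (a i)⁻¹) *
        (bmoConst n * bmoNorm f) := by
        rw [← Finset.sum_mul, Finset.mul_sum, ENNReal.ofReal_sum_of_nonneg fun i _ => by
          have := ha.2.1 i
          positivity]
    _ ≤ _ := by
        gcongr ENNReal.ofReal ?_ * _
        calc _ ≤ 4 * V * A * r * (lacConst δ * r⁻¹) := by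
              gcongr
              exact ha.sum_inv_le _ hr hN
          _ = _ := by field_simp

/-- The part of the transform at scales at most `r` nearly agrees, on balls of radius `r`, with
its action on the local part of `f`. -/
theorem enorm_diffTransform_sub_localPart_le (hφ : PoissonBounded φ A) (h1 : ∫ x, φ x = 1)
    (hf : MemBMO f) (ha : IsLacunary δ a) (ha2 : ∀ i, a (i + 1) / a i ≤ δ ^ 2)
    (hv : ∀ i, ‖v i‖ ≤ V) {c x : Eucl n} {r : ℝ} (hr : 0 < r) (hx : x ∈ ball c r) {N₁ N₂ : ℤ}
    (hN : ∀ i ∈ Finset.Icc N₁ N₂, a i < r) :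
    ‖diffTransform φ a v N₁ N₂ f x - diffTransform φ a v N₁ N₂ (localPart f c r) x‖ₑ ≤
      ENNReal.ofReal (V * (A * (2 ^ (n + 1) * (1 + δ ^ 2))) * lacConst δ) *
        (bmoConst n * bmoNorm f) := by
  have hV : 0 ≤ V := (norm_nonneg _).trans (hv 0)
  have hA := hφ.pos
  set e : ℤ → ℂ := fun i =>
    convOp φ (a i) f x - (⨍ y in ball c r, f y) - convOp φ (a i) (localPart f c r) x with he
  have hterm : ∀ i, ‖e i‖ₑ ≤ ENNReal.ofReal (A * (2 ^ (n + 1) * (a i / r))) *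
      (bmoConst n * bmoNorm f) := fun i =>
    enorm_convOp_sub_localPart_le hφ h1 hf (ha.2.1 i) hr hx
  calc _ = ‖∑ i ∈ Finset.Icc N₁ N₂, v i * (e (i + 1) - e i)‖ₑ := by
        simp only [diffTransform, he]
        rw [← Finset.sum_sub_distrib]
        congr 1
        exact Finset.sum_congr rfl fun i _ => by ring
    _ ≤ ∑ i ∈ Finset.Icc N₁ N₂, ENNReal.ofReal
        (V * (A * (2 ^ (n + 1) * (1 + δ ^ 2))) * r⁻¹ * a i) * (bmoConst n * bmoNorm f) := by
        refine (enorm_sum_le _ _).trans (Finset.sum_le_sum fun i hi => ?_)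
        have hai := ha.2.1 i
        have hai1 := ha.2.1 (i + 1)
        have hai2 : a (i + 1) ≤ δ ^ 2 * a i := (div_le_iff₀ hai).1 (ha2 i)
        rw [enorm_mul]
        calc _ ≤ ENNReal.ofReal V * (ENNReal.ofReal (A * (2 ^ (n + 1) * (a (i + 1) / r))) *
              (bmoConst n * bmoNorm f) + ENNReal.ofReal (A * (2 ^ (n + 1) * (a i / r))) *
              (bmoConst n * bmoNorm f)) := by
              exact mul_le_mul' (enorm_le_ofReal_of_norm_le (hv i)) (enorm_sub_le.trans
                (add_le_add (hterm _) (hterm _)))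
          _ = ENNReal.ofReal (V * (A * (2 ^ (n + 1) * (a (i + 1) / r)) +
              A * (2 ^ (n + 1) * (a i / r)))) * (bmoConst n * bmoNorm f) := by
              rw [← add_mul, ← mul_assoc, ← ENNReal.ofReal_add (by positivity) (by positivity),
                ← ENNReal.ofReal_mul hV]
          _ ≤ _ := by
              gcongr ENNReal.ofReal ?_ * _
              calc _ ≤ V * (A * (2 ^ (n + 1) * (δ ^ 2 * a i / r)) +
                    A * (2 ^ (n + 1) * (a i / r))) := by gcongr
                _ = _ := by ring
    _ = ENNReal.ofReal (V * (A * (2 ^ (n + 1) * (1 + δ ^ 2))) * r⁻¹ *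
        ∑ i ∈ Finset.Icc N₁ N₂, a i) * (bmoConst n * bmoNorm f) := by
        rw [← Finset.sum_mul, Finset.mul_sum, ENNReal.ofReal_sum_of_nonneg fun i _ => by
          have := ha.2.1 i
          positivity]
    _ ≤ _ := by
        gcongr ENNReal.ofReal ?_ * _
        calc _ ≤ V * (A * (2 ^ (n + 1) * (1 + δ ^ 2))) * r⁻¹ * (lacConst δ * r) := by
              gcongr
              exact ha.sum_le _ hr.le fun i hi => (hN i hi).le
          _ = _ := by field_simp

/-- A single difference of consecutive averages is bounded. -/
theorem enorm_diffTransform_self_le (hφ : PoissonBounded φ A) (h1 : ∫ x, φ x = 1)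
    (hf : MemBMO f) (ha : IsLacunary δ a) (ha2 : ∀ i, a (i + 1) / a i ≤ δ ^ 2)
    (hv : ∀ i, ‖v i‖ ≤ V) (x : Eucl n) (i : ℤ) :
    ‖diffTransform φ a v i i f x‖ₑ ≤ ENNReal.ofReal V *
      (2 * ENNReal.ofReal A * bmoConst n + ENNReal.ofReal ((δ ^ 2) ^ n)) * bmoNorm f := by
  have hai := ha.2.1 i
  have hai1 := ha.2.1 (i + 1)
  have hδ : 0 < δ ^ 2 := pow_pos (by linarith [ha.1]) 2
  have h2 := enorm_convOp_sub_average_le hφ h1 hf hai x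
  have h3 := enorm_convOp_sub_average_le hφ h1 hf hai1 x
  have h4 := enorm_average_sub_average_le hf.1 (c := x) (c' := x) hai hai1 hδ
    (ball_subset_ball (ha.monotone (by omega))) ((div_le_iff₀ hai).1 (ha2 i))
  rw [← edist_eq_enorm_sub] at h2 h3 h4
  simp only [diffTransform, Finset.Icc_self, Finset.sum_singleton]
  rw [enorm_mul, mul_assoc (ENNReal.ofReal V)]
  refine mul_le_mul' (enorm_le_ofReal_of_norm_le (hv i)) ?_
  rw [← edist_eq_enorm_sub]
  calc _ ≤ ENNReal.ofReal A * (bmoConst n * bmoNorm f) + ENNReal.ofReal ((δ ^ 2) ^ n) * bmoNorm f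
        + ENNReal.ofReal A * (bmoConst n * bmoNorm f) := by
        refine (edist_triangle4 _ (⨍ y in ball x (a (i + 1)), f y) (⨍ y in ball x (a i), f y)
          _).trans (add_le_add (add_le_add h3 ?_) ?_)
        · rwa [edist_comm]
        · rwa [edist_comm]
    _ = _ := by ring

/-- The constant in the pointwise comparison of the maximal transform at two points. -/
noncomputable def oscConst (n : ℕ) (δ V A : ℝ) : ℝ≥0∞ :=
  ENNReal.ofReal (V * (A * (2 ^ (n + 1) * (1 + δ ^ 2))) * lacConst δ) * bmoConst n +
    (ENNReal.ofReal (4 * V * A * lacConst δ) * bmoConst n + ENNReal.ofReal V *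
      (2 * ENNReal.ofReal A * bmoConst n + ENNReal.ofReal ((δ ^ 2) ^ n)))

theorem oscConst_ne_top (n : ℕ) (δ V A : ℝ) : oscConst n δ V A ≠ ∞ := by
  have := bmoConst_ne_top n
  unfold oscConst
  finiteness

/-- The supremum of the squared partial sums of the transform of the local part of `f`. -/
noncomputable def localMaxSq (φ : Eucl n → ℝ) (a : ℤ → ℝ) (v : ℤ → ℂ) (f : Eucl n → ℂ)
    (c : Eucl n) (r : ℝ) (x : Eucl n) : ℝ≥0∞ :=
  ⨆ (N₁ : ℤ) (N₂ : ℤ), ‖diffTransform φ a v N₁ N₂ (localPart f c r) x‖ₑ ^ 2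

theorem le_inv_mul_sq_add (u : ℝ≥0∞) {s : ℝ≥0∞} (hs : s ≠ 0) (hs' : s ≠ ∞) :
    u ≤ s⁻¹ * u ^ 2 + s := by
  rcases le_total u s with h | h
  · exact le_add_left h
  · refine le_add_right ?_
    calc u = s⁻¹ * (s * u) := by rw [← mul_assoc, ENNReal.inv_mul_cancel hs hs', one_mul]
      _ ≤ s⁻¹ * (u * u) := by gcongr
      _ = _ := by rw [sq]

/-- The maximal transform at `x` exceeds its value at another point `y` of the same ball by at
most the contribution of the local part of `f`, linearized at the level `s`, and a multiple of
the `BMO` seminorm. -/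
theorem maxDiffTransform_le (hφ : PoissonBounded φ A) (h1 : ∫ x, φ x = 1)
    (hf : MemBMO f) (ha : IsLacunary δ a) (ha2 : ∀ i, a (i + 1) / a i ≤ δ ^ 2)
    (hv : ∀ i, ‖v i‖ ≤ V) {c x y : Eucl n} {r : ℝ} (hr : 0 < r) (hx : x ∈ ball c r)
    (hy : y ∈ ball c r) {s : ℝ≥0∞} (hs : s ≠ 0) (hs' : s ≠ ∞) :
    maxDiffTransform φ a v f x ≤ s⁻¹ * localMaxSq φ a v f c r x
      + (s + oscConst n δ V A * bmoNorm f) + maxDiffTransform φ a v f y := by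
  refine iSup_le fun N₁ => iSup_le fun N₂ => iSup_le fun h12 => ?_
  obtain ⟨m, hm1, hm2, hsmall, hlarge⟩ := ha.exists_split r N₁ N₂ h12.le
  rw [diffTransform_eq_add hm1 hm2]
  have hS : ‖diffTransform φ a v N₁ m f x‖ₑ ≤ (s⁻¹ * localMaxSq φ a v f c r x + s) +
      ENNReal.ofReal (V * (A * (2 ^ (n + 1) * (1 + δ ^ 2))) * lacConst δ) *
        (bmoConst n * bmoNorm f) := by
    calc _ = ‖diffTransform φ a v N₁ m (localPart f c r) x + (diffTransform φ a v N₁ m f x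
          - diffTransform φ a v N₁ m (localPart f c r) x)‖ₑ := by rw [add_sub_cancel]
      _ ≤ _ := (enorm_add_le _ _).trans (add_le_add ?_
          (enorm_diffTransform_sub_localPart_le hφ h1 hf ha ha2 hv hr hx hsmall))
    refine (le_inv_mul_sq_add _ hs hs').trans ?_
    gcongr
    exact le_iSup_of_le N₁ (le_iSup_of_le m le_rfl)
  have hB : ‖diffTransform φ a v (m + 1) N₂ f x‖ₑ ≤ maxDiffTransform φ a v f y +
      (ENNReal.ofReal (4 * V * A * lacConst δ) * bmoConst n + ENNReal.ofReal V *
      (2 * ENNReal.ofReal A * bmoConst n + ENNReal.ofReal ((δ ^ 2) ^ n))) * bmoNorm f := by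
    rcases lt_trichotomy (m + 1) N₂ with h | h | h
    · calc _ = ‖diffTransform φ a v (m + 1) N₂ f y + (diffTransform φ a v (m + 1) N₂ f x
            - diffTransform φ a v (m + 1) N₂ f y)‖ₑ := by rw [add_sub_cancel]
        _ ≤ maxDiffTransform φ a v f y +
            ENNReal.ofReal (4 * V * A * lacConst δ) * (bmoConst n * bmoNorm f) :=
          (enorm_add_le _ _).trans (add_le_add
            (le_iSup_of_le (m + 1) (le_iSup_of_le N₂ (le_iSup_of_le h le_rfl)))
            (enorm_diffTransform_sub_le_of_le hφ h1 hf ha hv hr hx hy hlarge))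
        _ ≤ _ := by
          refine add_le_add le_rfl ?_
          rw [← mul_assoc]
          exact mul_le_mul' le_self_add le_rfl
    · -- a single term is not among the sums defining the maximal transform at `y`
      rw [h]
      exact (enorm_diffTransform_self_le hφ h1 hf ha ha2 hv x N₂).trans
        (le_add_left (mul_le_mul' le_add_self le_rfl))
    · simp [diffTransform, Finset.Icc_eq_empty (not_le.2 h)]
  calc _ ≤ _ := (enorm_add_le _ _).trans (add_le_add hS hB)
    _ = _ := by rw [oscConst]; ring

end

/-! ### Lower oscillation of the maximal transform -/

section

variable {n : ℕ} {φ : 𝓢(Eucl n, ℝ)} {δ V L A : ℝ} {a : ℤ → ℝ} {v : ℤ → ℂ} {f : Eucl n → ℂ}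

theorem measurable_maxDiffTransform (hφ : PoissonBounded (φ : Eucl n → ℝ) A)
    (h1 : ∫ x, φ x = 1) (hf : MemBMO f) (ha : IsLacunary δ a) :
    Measurable (maxDiffTransform φ a v f) := by
  have hc := fun i => continuous_convOp hφ h1 hf (ha.2.1 i)
  refine Measurable.iSup fun N₁ => Measurable.iSup fun N₂ => Measurable.iSup fun _ => ?_
  have h2 : Continuous fun x => diffTransform φ a v N₁ N₂ f x :=
    continuous_finsetSum _ fun i _ => continuous_const.mul ((hc _).sub (hc _))
  exact h2.enorm.measurable

/-- The constant in the mean square bound for the local contribution. -/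
noncomputable def localConst (n : ℕ) (δ V L A : ℝ) : ℝ≥0∞ :=
  maxConst n δ V L A * (52 * 2 ^ n * (2 * 4 ^ n * (8 * 5 ^ n)) ^ 2)

theorem localConst_ne_top (n : ℕ) (δ V L A : ℝ) : localConst n δ V L A ≠ ∞ := by
  have := maxConst_ne_top n δ V L A
  unfold localConst
  finiteness

theorem lintegral_localMaxSq_le (hn : 1 ≤ n) (hφ : PoissonBounded (φ : Eucl n → ℝ) A)
    (hp : MultBounded (symbol φ : Eucl n → ℂ) L) (hf : MemBMO f) (ha : IsLacunary δ a)
    (ha2 : ∀ i, a (i + 1) / a i ≤ δ ^ 2) (hv : ∀ i, ‖v i‖ ≤ V) (c : Eucl n) {r : ℝ}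
    (hr : 0 < r) :
    ∫⁻ x, localMaxSq φ a v f c r x ≤
      volume (ball c r) * (localConst n δ V L A * bmoNorm f ^ 2) := by
  have hb := hf.2.ne
  have hfin : ∫⁻ z, ‖localPart f c r z‖ₑ ^ 2 < ∞ := by
    refine (lintegral_localPart_sq_le hn hf c hr).trans_lt ?_
    have := volume_ball_ne_top c r
    unfold stopHeight
    finiteness
  have hmem : MemLp (localPart f c r) 2 := by
    refine ⟨aestronglyMeasurable_localPart hf.1 c r, ?_⟩
    rw [lintegral_enorm_sq_eq] at hfin
    by_contra hcon
    rw [not_lt_top_iff.1 hcon] at hfin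
    simp at hfin
  calc _ ≤ maxConst n δ V L A * ∫⁻ z, ‖localPart f c r z‖ₑ ^ 2 :=
        lintegral_iSup_diffTransform_le hn hφ hp ha ha2 hv hmem
    _ ≤ maxConst n δ V L A * (volume (ball c r) * (52 * 2 ^ n * stopHeight f ^ 2)) := by
        gcongr; exact lintegral_localPart_sq_le hn hf c hr
    _ = _ := by rw [localConst, stopHeight]; ring

theorem lintegral_ball_local_le (hn : 1 ≤ n) (hφ : PoissonBounded (φ : Eucl n → ℝ) A)
    (hp : MultBounded (symbol φ : Eucl n → ℂ) L) (hf : MemBMO f) (ha : IsLacunary δ a)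
    (ha2 : ∀ i, a (i + 1) / a i ≤ δ ^ 2) (hv : ∀ i, ‖v i‖ ≤ V) (c : Eucl n) {r : ℝ}
    (hr : 0 < r) {s : ℝ≥0∞} (hs : s ≠ 0) (b : ℝ≥0∞) :
    ∫⁻ x in ball c r, (s⁻¹ * localMaxSq φ a v f c r x + b) ≤
      volume (ball c r) * (s⁻¹ * (localConst n δ V L A * bmoNorm f ^ 2) + b) := by
  rw [lintegral_add_right _ measurable_const, setLIntegral_const,
    lintegral_const_mul' _ _ (ENNReal.inv_ne_top.2 hs)]
  calc _ ≤ s⁻¹ * (volume (ball c r) * (localConst n δ V L A * bmoNorm f ^ 2))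
        + b * volume (ball c r) := by
        gcongr
        exact (setLIntegral_le_lintegral _ _).trans
          (lintegral_localMaxSq_le hn hφ hp hf ha ha2 hv c hr)
    _ = _ := by ring

theorem lintegral_ball_maxDiffTransform_ne_top (hn : 1 ≤ n)
    (hφ : PoissonBounded (φ : Eucl n → ℝ) A) (hp : MultBounded (symbol φ : Eucl n → ℂ) L)
    (h1 : ∫ x, φ x = 1) (hf : MemBMO f) (ha : IsLacunary δ a)
    (ha2 : ∀ i, a (i + 1) / a i ≤ δ ^ 2) (hv : ∀ i, ‖v i‖ ≤ V) {c y : Eucl n} {r : ℝ}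
    (hr : 0 < r) (hy : y ∈ ball c r) (hfin : maxDiffTransform φ a v f y < ∞) :
    ∫⁻ x in ball c r, maxDiffTransform φ a v f x ≠ ∞ := by
  have hb := hf.2.ne
  have h2 : ∫⁻ x in ball c r, maxDiffTransform φ a v f x ≤ _ :=
    (setLIntegral_mono' measurableSet_ball fun x hx => (maxDiffTransform_le hφ h1 hf ha ha2 hv hr
      hx hy one_ne_zero ENNReal.one_ne_top).trans (add_assoc _ _ _).le).trans
      (lintegral_ball_local_le hn hφ hp hf ha ha2 hv c hr one_ne_zero _)
  refine ne_top_of_le_ne_top ?_ h2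
  have h3 := volume_ball_ne_top c r
  have h4 := localConst_ne_top n δ V L A
  have h5 := oscConst_ne_top n δ V A
  have h6 := hfin.ne
  simp only [inv_one, one_mul]
  finiteness

/-- Finiteness of the maximal transform at one point propagates to almost every point. -/
theorem ae_maxDiffTransform_lt_top (hn : 1 ≤ n)
    (hφ : PoissonBounded (φ : Eucl n → ℝ) A) (hp : MultBounded (symbol φ : Eucl n → ℂ) L)
    (h1 : ∫ x, φ x = 1) (hf : MemBMO f) (ha : IsLacunary δ a)
    (ha2 : ∀ i, a (i + 1) / a i ≤ δ ^ 2) (hv : ∀ i, ‖v i‖ ≤ V) {y : Eucl n}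
    (hfin : maxDiffTransform φ a v f y < ∞) :
    ∀ᵐ x, maxDiffTransform φ a v f x < ∞ := by
  have hk : ∀ k : ℕ, ∀ᵐ x, x ∈ ball y (k + 1) → maxDiffTransform φ a v f x < ∞ := fun k => by
    rw [← ae_restrict_iff' measurableSet_ball]
    have hk0 : (0 : ℝ) < k + 1 := by positivity
    exact ae_lt_top (measurable_maxDiffTransform hφ h1 hf ha)
      (lintegral_ball_maxDiffTransform_ne_top hn hφ hp h1 hf ha ha2 hv hk0
        (mem_ball_self hk0) hfin)
  filter_upwards [ae_all_iff.2 hk] with x hx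
  obtain ⟨k, hk⟩ := exists_nat_gt (dist x y)
  exact hx k (mem_ball.2 (by linarith))

theorem locallyIntegrable_maxDiffTransform (hn : 1 ≤ n)
    (hφ : PoissonBounded (φ : Eucl n → ℝ) A) (hp : MultBounded (symbol φ : Eucl n → ℂ) L)
    (h1 : ∫ x, φ x = 1) (hf : MemBMO f) (ha : IsLacunary δ a)
    (ha2 : ∀ i, a (i + 1) / a i ≤ δ ^ 2) (hv : ∀ i, ‖v i‖ ≤ V)
    (hae : ∀ᵐ x, maxDiffTransform φ a v f x < ∞) :
    LocallyIntegrable fun x => (maxDiffTransform φ a v f x).toReal := by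
  obtain ⟨y, hy⟩ := hae.exists
  intro x
  have hr : 0 < dist y x + 1 := by positivity
  refine ⟨ball x (dist y x + 1), ball_mem_nhds x hr, ?_⟩
  exact integrable_toReal_of_lintegral_ne_top
    (measurable_maxDiffTransform hφ h1 hf ha).aemeasurable
    (lintegral_ball_maxDiffTransform_ne_top hn hφ hp h1 hf ha ha2 hv hr
      (mem_ball.2 (by linarith)) hy)

/-- The values of the maximal transform on a ball exceed its essential infimum there by
at most the local contribution. -/
theorem toENNReal_sub_essInf_le (hφ : PoissonBounded (φ : Eucl n → ℝ) A)
    (h1 : ∫ x, φ x = 1) (hf : MemBMO f) (ha : IsLacunary δ a)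
    (ha2 : ∀ i, a (i + 1) / a i ≤ δ ^ 2) (hv : ∀ i, ‖v i‖ ≤ V)
    (hae : ∀ᵐ x, maxDiffTransform φ a v f x < ∞) {c x : Eucl n} {r : ℝ} (hr : 0 < r)
    (hx : x ∈ ball c r) {s : ℝ≥0∞} (hs : s ≠ 0) (hs' : s ≠ ∞) :
    (((maxDiffTransform φ a v f x).toReal : EReal) -
      essInf (fun y => ((maxDiffTransform φ a v f y).toReal : EReal))
        (volume.restrict (ball c r))).toENNReal ≤
      s⁻¹ * localMaxSq φ a v f c r x + (s + oscConst n δ V A * bmoNorm f) := by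
  set Z := s⁻¹ * localMaxSq φ a v f c r x + (s + oscConst n δ V A * bmoNorm f) with hZ
  by_cases hZtop : Z = ∞
  · rw [hZtop]; exact le_top
  have hess : (((maxDiffTransform φ a v f x).toReal - Z.toReal : ℝ) : EReal) ≤
      essInf (fun y => ((maxDiffTransform φ a v f y).toReal : EReal))
        (volume.restrict (ball c r)) := by
    refine le_essInf_of_ae_le _ ?_
    filter_upwards [ae_restrict_mem measurableSet_ball, ae_restrict_of_ae hae] with y hy hyfin
    have h2 := maxDiffTransform_le hφ h1 hf ha ha2 hv hr hx hy hs hs'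
    have h3 := ENNReal.toReal_mono (ENNReal.add_ne_top.2 ⟨hZtop, hyfin.ne⟩) h2
    rw [ENNReal.toReal_add hZtop hyfin.ne] at h3
    exact EReal.coe_le_coe_iff.2 (by linarith)
  calc _ ≤ (((maxDiffTransform φ a v f x).toReal : EReal) -
        (((maxDiffTransform φ a v f x).toReal - Z.toReal : ℝ) : EReal)).toENNReal :=
        EReal.toENNReal_le_toENNReal (EReal.sub_le_sub le_rfl hess)
    _ = ENNReal.ofReal Z.toReal := by
        rw [← EReal.coe_sub, sub_sub_cancel, EReal.toENNReal_of_ne_top (EReal.coe_ne_top _),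
          EReal.toReal_coe]
    _ = Z := ENNReal.ofReal_toReal hZtop

theorem bloNorm_maxDiffTransform_le (hn : 1 ≤ n)
    (hφ : PoissonBounded (φ : Eucl n → ℝ) A) (hp : MultBounded (symbol φ : Eucl n → ℂ) L)
    (h1 : ∫ x, φ x = 1) (hf : MemBMO f) (ha : IsLacunary δ a)
    (ha2 : ∀ i, a (i + 1) / a i ≤ δ ^ 2) (hv : ∀ i, ‖v i‖ ≤ V)
    (hae : ∀ᵐ x, maxDiffTransform φ a v f x < ∞) :
    bloNorm (fun x => (maxDiffTransform φ a v f x).toReal) ≤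
      (localConst n δ V L A + 1 + oscConst n δ V A) * bmoNorm f := by
  have key : ∀ s : ℝ≥0∞, s ≠ 0 → s ≠ ∞ →
      bloNorm (fun x => (maxDiffTransform φ a v f x).toReal) ≤
      s⁻¹ * (localConst n δ V L A * bmoNorm f ^ 2) + (s + oscConst n δ V A * bmoNorm f) := by
    intro s hs hs'
    refine iSup_le fun c => iSup_le fun r => iSup_le fun hr => ?_
    rw [← ENNReal.div_eq_inv_mul]
    refine ENNReal.div_le_of_le_mul' ?_
    exact (setLIntegral_mono' measurableSet_ball fun x hx =>
      toENNReal_sub_essInf_le hφ h1 hf ha ha2 hv hae hr hx hs hs').trans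
      (lintegral_ball_local_le hn hφ hp hf ha ha2 hv c hr hs _)
  by_cases hb0 : bmoNorm f = 0
  · -- here the local contribution vanishes, and the level `s` can be taken arbitrarily small
    rw [hb0, mul_zero]
    refine le_of_forall_gt_imp_ge_of_dense fun s hs => ?_
    by_cases hs' : s = ∞
    · rw [hs']; exact le_top
    · simpa [hb0] using key s hs.ne' hs'
  · refine (key _ hb0 hf.2.ne).trans (le_of_eq ?_)
    rw [show (bmoNorm f)⁻¹ * (localConst n δ V L A * bmoNorm f ^ 2)
      = localConst n δ V L A * bmoNorm f * ((bmoNorm f)⁻¹ * bmoNorm f) by ring,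
      ENNReal.inv_mul_cancel hb0 hf.2.ne]
    ring

end

theorem mainTheorem3 (n : ℕ) (hn : 1 ≤ n) (φ : 𝓢(EuclideanSpace ℝ (Fin n), ℝ))
    (hφ : ∫ x, φ x = 1) (δ : ℝ) (V : ℝ) :
    ∃ C : ℝ, 0 < C ∧
      ∀ a : ℤ → ℝ, IsLacunary δ a → (∀ i, a (i + 1) / a i ≤ δ ^ 2) →
      ∀ v : ℤ → ℂ, (∀ i, ‖v i‖ ≤ V) →
      ∀ f : EuclideanSpace ℝ (Fin n) → ℂ, MemBMO f →
        ((∀ x, maxDiffTransform φ a v f x = ∞) ∨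
          (∀ᵐ x, maxDiffTransform φ a v f x < ∞)) ∧
        ((∀ᵐ x, maxDiffTransform φ a v f x < ∞) →
          MemBLO (fun x => (maxDiffTransform φ a v f x).toReal) ∧
          bloNorm (fun x => (maxDiffTransform φ a v f x).toReal) ≤
            ENNReal.ofReal C * bmoNorm f) := by
  obtain ⟨A, hA⟩ := exists_poissonBounded φ
  obtain ⟨L, hp⟩ := exists_multBounded φ hφ
  set C : ℝ≥0∞ := localConst n δ V L A + 1 + oscConst n δ V A with hC
  have hCfin : C ≠ ∞ := by
    have h1 := localConst_ne_top n δ V L A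
    have h2 := oscConst_ne_top n δ V A
    finiteness
  refine ⟨C.toReal + 1, by positivity, fun a ha ha2 v hv f hf => ⟨?_, fun hae => ?_⟩⟩
  · by_cases hall : ∀ x, maxDiffTransform φ a v f x = ∞
    · exact Or.inl hall
    · push Not at hall
      obtain ⟨y, hy⟩ := hall
      exact Or.inr (ae_maxDiffTransform_lt_top hn hA hp hφ hf ha ha2 hv hy.lt_top)
  · have hle : bloNorm (fun x => (maxDiffTransform φ a v f x).toReal) ≤
        ENNReal.ofReal (C.toReal + 1) * bmoNorm f := by
      refine (bloNorm_maxDiffTransform_le hn hA hp hφ hf ha ha2 hv hae).trans ?_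
      gcongr
      rw [← hC]
      exact (ENNReal.ofReal_toReal hCfin).ge.trans (ENNReal.ofReal_le_ofReal (by linarith))
    exact ⟨⟨locallyIntegrable_maxDiffTransform hn hA hp hφ hf ha ha2 hv hae,
      hle.trans_lt (ENNReal.mul_lt_top ENNReal.ofReal_lt_top hf.2)⟩, hle⟩
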